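/- **Definitions.** For a set $L\subset\mathbb N_0$, let $\Delta(L)$ be the set of all positive integers $d$ such that $L\cap[a,a+d]=\{a,a+d\}$ for some $a\in L$. For a commutative cancellative monoid $H$ and $a\in H$, let $\mathsf L(a)\subset\mathbb N_0$ be the set of all $k$ such that $a$ is, up to a unit, a product of $k$ atoms of $H$ (so $\mathsf L(a)=\{0\}$ if $a$ is a unit), and let $\Delta(H)=\bigcup_{a\in H}\Delta(\mathsf L(a))$. A submonoid $S\subset H$ is divisor-closed if $a\in H$, $b\in S$ and $a\mid b$ in $H$ imply $a\in S$. Let $\Delta^*(H)$ be the set of all $\min\Delta(S)$, where $S$ runs over the divisor-closed submonoids of $H$ with $\Delta(S)\neq\emptyset$. For a finite group $G$, a sequence over $G$ is an element of the free abelian monoid $\mathcal F(G)$ with basis $G$ (a finite unordered sequence of elements of $G$, repetition allowed), and $|S|$ denotes the number of terms of $S$, counted with multiplicity. Let $\mathcal B(G)\subset\mathcal F(G)$ be the submonoid of all product-one sequences, i.e. those sequences whose terms can be ordered so that their product in $G$ is $1_G$ (including the empty sequence). Put $\Delta^*(G)=\Delta^*(\mathcal B(G))$, and let the large Davenport constant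 $\mathsf D(G)$ be the maximum of $|S|$ over all atoms $S$ of $\mathcal B(G)$. **Theorem.** Let $G$ be a finite group with $|G|\ge 3$. 1. $1\in\Delta^*(G)$, and $\operatorname{ord}(g)-2\in\Delta^*(G)$ for every $g\in G$ with $\operatorname{ord}(g)\ge 3$. 2. $\Delta^*(G)$ has a maximum and $\max\Delta^*(G)\le\mathsf D(G)-2$. 3. $\max\Delta^*(G)=|G|-2$ if and only if $G$ is cyclic or $G$ is a dihedral group of order $2n$ for some odd $n\ge 3$. 4. If $G$ is a dihedral group of order $2n$ for some odd $n\ge 3$, then $\{1,2,n-2,2n-2\}\subset\Delta^*(G)$ and $\max\bigl(\Delta^*(G)\setminus\{2n-2\}\bigr)=\max\{2,n-2\}$. 5. If $\max\Delta^*(G)=\mathsf D(G)-2$, then $G$ is cyclic or there is a subgroup $G_1\subset G$ (possibly $G_1=G$) such that $\mathsf D(G_1)=\mathsf D(G)$ and $G_1$ is generated by elements of order two. -/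

import Mathlib

namespace ProductOne

section Monoids

variable (H : Type*) [CommMonoid H]

/-- The set of distances of a set `L` of natural numbers: all positive `d` such that
`L ∩ [a, a + d] = {a, a + d}` for some `a ∈ L`. -/
def distances (L : Set ℕ) : Set ℕ :=
  {d | 0 < d ∧ ∃ a ∈ L, L ∩ Set.Icc a (a + d) = {a, a + d}}

variable {H} in
/-- The set of lengths of `a`: the lengths of the factorizations of (the class of) `a` into
atoms of the associated reduced monoid `Associates H`; a factorization is a multiset of atoms. -/
def lengths (a : H) : Set ℕ :=
  {k | ∃ z : Multiset (Associates H),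
    (∀ u ∈ z, Irreducible u) ∧ z.prod = Associates.mk a ∧ Multiset.card z = k}

/-- The set of distances of a monoid. -/
def monoidDistances : Set ℕ := ⋃ a : H, distances (lengths a)

variable {H} in
/-- Divisor-closed submonoids. -/
def IsDivisorClosed (S : Submonoid H) : Prop :=
  ∀ a b : H, b ∈ S → a ∣ b → a ∈ S

/-- The set of minimal distances of a monoid: all `min Δ(S)`, where `S` is a divisor-closed
submonoid with `Δ(S)` nonempty. -/
def minimalDistances : Set ℕ :=
  {d | ∃ S : Submonoid H, IsDivisorClosed S ∧ IsLeast (monoidDistances S) d}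

end Monoids

section Groups

variable (G : Type*) [Group G]

variable {G} in
/-- The set of products of a sequence (finite multiset) `S` over `G`, in all orders. -/
def products (S : Multiset G) : Set G :=
  {g | ∃ l : List G, (l : Multiset G) = S ∧ l.prod = g}

/-- The monoid of product-one sequences over `G`, as a submonoid of the free abelian monoid
with basis `G`, which is `Multiset G` written multiplicatively. -/
def productOneMonoid : Submonoid (Multiplicative (Multiset G)) where
  carrier := {S | (1 : G) ∈ products (Multiplicative.toAdd S)}
  one_mem' := ⟨[], rfl, rfl⟩
  mul_mem' := by
    rintro S T ⟨l, hl, hl1⟩ ⟨m, hm, hm1⟩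
    refine ⟨l ++ m, ?_, by simp [hl1, hm1]⟩
    rw [toAdd_mul, ← hl, ← hm, Multiset.coe_add]

/-- `Δ*(G)`: the set of minimal distances of the monoid of product-one sequences over `G`. -/
def deltaStar : Set ℕ := minimalDistances (productOneMonoid G)

/-- The lengths `|S|` of the minimal product-one sequences `S` over `G`. -/
def atomSizes : Set ℕ :=
  {k | ∃ S : productOneMonoid G, Irreducible S ∧
    Multiset.card (Multiplicative.toAdd (S : Multiplicative (Multiset G))) = k}

/-- The large Davenport constant `D(G)`, the maximal length of a minimal product-one sequence
(for finite `G`, see `isGreatest_davenport`). -/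
noncomputable def davenport : ℕ := sSup (atomSizes G)

variable {G} in
theorem isUnit_iff_size (S : productOneMonoid G) :
    IsUnit S ↔
      Multiset.card (Multiplicative.toAdd (S : Multiplicative (Multiset G))) = 0 := by
  constructor
  · rintro ⟨u, rfl⟩
    have h := congrArg (fun x : productOneMonoid G =>
      Multiset.card (Multiplicative.toAdd (x : Multiplicative (Multiset G)))) u.mul_inv
    simp only [Submonoid.coe_mul, toAdd_mul, Multiset.card_add, Submonoid.coe_one, toAdd_one,
      Multiset.card_zero] at h
    omega
  · intro h
    have : S = 1 := by
      apply Subtype.ext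
      apply Multiplicative.toAdd.injective
      simpa using h
    rw [this]; exact isUnit_one

theorem atomSizes_le [Finite G] {k : ℕ} (hk : k ∈ atomSizes G) : k ≤ Nat.card G := by
  obtain ⟨⟨S, l, hl, hl1⟩, hS, rfl⟩ := hk
  by_contra! hlt
  have hlen : l.length = Multiset.card (Multiplicative.toAdd S) := by
    rw [← hl, Multiset.coe_card]
  simp only at hlt
  rw [← hlen] at hlt
  have := Fintype.ofFinite G
  obtain ⟨i, j, hij, he⟩ := Fintype.exists_ne_map_eq_of_card_lt
    (fun i : Fin l.length => (l.take (i + 1)).prod)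
    (by rw [Fintype.card_fin, ← Nat.card_eq_fintype_card]; exact hlt)
  wlog hlt' : i < j generalizing i j
  · exact this j i hij.symm he.symm (lt_of_le_of_ne (not_lt.mp hlt') hij.symm)
  have hi := i.2
  have hj := j.2
  have hij' : (i : ℕ) < j := hlt'
  set a := l.take (i + 1) with ha
  set b := (l.drop (i + 1)).take (j - i) with hb
  set c := l.drop (j + 1) with hc
  have hab : l.take (j + 1) = a ++ b := by
    rw [ha, hb, ← List.take_add]; congr 1; omega
  have habc : a ++ b ++ c = l := by rw [← hab, hc, List.take_append_drop]
  have hb1 : b.prod = 1 := by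
    have he' : a.prod = (l.take (j + 1)).prod := he
    rw [hab, List.prod_append] at he'
    simpa using he'
  have hac : (a ++ c).prod = 1 := by
    rw [← habc, List.prod_append, List.prod_append, hb1, mul_one] at hl1
    rw [List.prod_append, hl1]
  let A : productOneMonoid G :=
    ⟨Multiplicative.ofAdd ((a ++ c : List G) : Multiset G), a ++ c, rfl, hac⟩
  let B : productOneMonoid G := ⟨Multiplicative.ofAdd (b : Multiset G), b, rfl, hb1⟩
  have hprod : (⟨S, l, hl, hl1⟩ : productOneMonoid G) = A * B := by
    apply Subtype.ext
    apply Multiplicative.toAdd.injective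
    change Multiplicative.toAdd S = ((a ++ c : List G) : Multiset G) + (b : Multiset G)
    rw [← hl, ← habc, ← Multiset.coe_add, ← Multiset.coe_add, ← Multiset.coe_add]
    abel
  rcases hS.isUnit_or_isUnit hprod with h | h
  · rw [isUnit_iff_size] at h
    change Multiset.card ((a ++ c : List G) : Multiset G) = 0 at h
    simp [ha] at h
  · rw [isUnit_iff_size] at h
    change Multiset.card (b : Multiset G) = 0 at h
    simp [hb] at h
    omega

/-- For finite `G` the large Davenport constant is a genuine maximum. -/
theorem isGreatest_davenport [Finite G] : IsGreatest (atomSizes G) (davenport G) := by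
  have hb : BddAbove (atomSizes G) := ⟨Nat.card G, fun _ hk => atomSizes_le G hk⟩
  refine ⟨Nat.sSup_mem ⟨1, ?_⟩ hb, fun k hk => le_csSup hb hk⟩
  refine ⟨⟨Multiplicative.ofAdd {1}, [1], rfl, by simp⟩, ⟨?_, ?_⟩, by simp⟩
  · rw [isUnit_iff_size]; simp
  · intro A B h
    rw [isUnit_iff_size, isUnit_iff_size]
    have h' := congrArg (fun x : productOneMonoid G =>
      Multiset.card (Multiplicative.toAdd (x : Multiplicative (Multiset G)))) h
    simp only [Submonoid.coe_mul, toAdd_mul, Multiset.card_add, toAdd_ofAdd,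
      Multiset.card_singleton] at h'
    omega

end Groups

end ProductOne

/-!
A divisor-closed submonoid of the monoid of product-one sequences consists of all product-one
sequences over some subset `G₀` of `G`: if the product-one sequences `V₁, …, Vₗ` contain the terms
`g₁, …, gₗ` of a product-one sequence `U`, then cyclic reorderings of the `Vᵢ` show that `U` divides
`V₁ ⋯ Vₗ` (`exists_complement`). The minimum of the set of distances divides all differences of
lengths, so `d` is a minimal distance if and only if, for some `G₀`, the number `d` divides all such
differences and is one of them (`mem_deltaStar_iff`). Membership is then shown by an explicit
relation and a weight that determines lengths modulo `d` (`dvdLengthDiffs_of_weight`).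

The upper bound rests on the same exchange `V₁ ⋯ Vₗ = U · W` with minimal `U` and `Vᵢ`. If no
factorization of `W` had fewer than `l - 1` factors, then extracting the factors of a factorization
`y` one by one from a high power of another factorization `x` would give `|x| ≤ |y|`, and all
lengths would agree (`card_le_of_exchange`). So some exchange shortens a factorization, and hence
does so by a multiple of `d`; this requires a minimal sequence `U` with at least `d + 2` terms.
In the extremal case `|U| = d + 2 = D(G)`, all the `Vᵢ` are `gᵢ · gᵢ⁻¹`
(`exists_long_isMinimal`), and then `ord gᵢ ≥ 3` would imply `ord gᵢ = D(G)`, which holds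
in cyclic groups only (`orderOf_lt_davenport`). So all terms of `U` are involutions.

If moreover `|U| = |G|`, then the partial products of `U` form a Hamiltonian cycle of a Cayley
graph. Over involutions a product-one sequence with fewer than `d + 2` terms has even multiplicities
(`DvdLengthDiffs.le_card_of_odd_count`), which excludes chords of this cycle. Thus `U` alternates
between two involutions and `G` is dihedral (`exists_dihedral_of_isMinimal`).

In a dihedral group of order `2n` with `n` odd, a set `G₀` containing a nontrivial rotation and
a reflection gives `d ≤ 2`, and a set of rotations gives `d ≤ n - 2`. Over reflections, `d ≥ n - 1`
and `d ≥ 3` would force any of three reflections to be the midpoint of the other two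
(`midpoint_of_reflections`), which is impossible; and over at most two reflections
lengths are determined modulo `2n - 2` (`dvdLengthDiffs_reflections`).
-/

namespace ProductOne

/-! ### Product-one sequences, minimal ones, and lengths -/

section Sequences

variable {G : Type*} [Group G]

/-- A sequence over `G` is product-one if its terms can be ordered so that their product is `1`. -/
def IsProductOne (S : Multiset G) : Prop := (1 : G) ∈ products S

theorem isProductOne_coe {l : List G} (h : l.prod = 1) : IsProductOne (l : Multiset G) :=
  ⟨l, rfl, h⟩

theorem isProductOne_zero : IsProductOne (0 : Multiset G) := ⟨[], rfl, rfl⟩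

theorem IsProductOne.add {S T : Multiset G} (hS : IsProductOne S) (hT : IsProductOne T) :
    IsProductOne (S + T) := by
  obtain ⟨l, rfl, hl⟩ := hS
  obtain ⟨m, rfl, hm⟩ := hT
  exact ⟨l ++ m, by simp, by simp [hl, hm]⟩

theorem isProductOne_sum {z : Multiset (Multiset G)} (h : ∀ A ∈ z, IsProductOne A) :
    IsProductOne z.sum := by
  induction z using Multiset.induction_on with
  | empty => simpa using isProductOne_zero
  | cons A z ih =>
    rw [Multiset.sum_cons]
    exact (h A (by simp)).add (ih fun B hB => h B (by simp [hB]))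

theorem isProductOne_pair {g h : G} (hgh : g * h = 1) : IsProductOne ({g, h} : Multiset G) :=
  ⟨[g, h], rfl, by simpa using hgh⟩

theorem isProductOne_singleton {g : G} : IsProductOne ({g} : Multiset G) ↔ g = 1 := by
  constructor
  · rintro ⟨l, hl, h⟩
    rw [Multiset.coe_eq_singleton] at hl
    simpa [hl] using h
  · rintro rfl
    exact ⟨[1], rfl, by simp⟩

theorem isProductOne_replicate {g : G} {n : ℕ} :
    IsProductOne (Multiset.replicate n g) ↔ g ^ n = 1 := by
  constructor
  · rintro ⟨l, hl, h⟩
    rw [← Multiset.coe_replicate, Multiset.coe_eq_coe, List.perm_replicate] at hl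
    simpa [hl] using h
  · intro h
    exact ⟨List.replicate n g, Multiset.coe_replicate n g, by rwa [List.prod_replicate]⟩

/-- A product-one sequence can be ordered with any prescribed term in front. -/
theorem IsProductOne.exists_cons {S : Multiset G} (hS : IsProductOne S) {g : G} (hg : g ∈ S) :
    ∃ l : List G, ((g :: l : List G) : Multiset G) = S ∧ (g :: l).prod = 1 := by
  obtain ⟨l, rfl, hl⟩ := hS
  obtain ⟨s, t, rfl⟩ := List.append_of_mem (Multiset.mem_coe.1 hg)
  refine ⟨t ++ s, ?_, ?_⟩
  · rw [Multiset.coe_eq_coe, ← List.cons_append]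
    exact List.perm_append_comm
  · rw [List.prod_append] at hl
    rw [← List.cons_append, List.prod_append]
    exact mul_eq_one_comm.1 hl

/-- If the `i`-th term of the list `l` occurs in the `i`-th member of a family of product-one
sequences, then `l` can be continued, inside the sum of the family, to a list with product one:
each cyclic reordering of a member `V ∋ g` as `g, v₁, …, vₖ` supplies an inverse `v₁ ⋯ vₖ`
of `g`. -/
theorem exists_complement {l : List G} {V : List (Multiset G)}
    (h : List.Forall₂ (fun g S => g ∈ S) l V) (hV : ∀ S ∈ V, IsProductOne S) :
    ∃ w : List G, l.prod * w.prod = 1 ∧ (l : Multiset G) + (w : Multiset G) = V.sum := by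
  induction h with
  | nil => exact ⟨[], by simp, by simp⟩
  | @cons g S l V hg _ ih =>
    obtain ⟨w, hw1, hw2⟩ := ih fun T hT => hV T (by simp [hT])
    obtain ⟨v, hv1, hv2⟩ := (hV S (by simp)).exists_cons hg
    refine ⟨w ++ v, ?_, ?_⟩
    · rw [List.prod_cons, List.prod_append, mul_assoc, ← mul_assoc l.prod, hw1, one_mul,
        ← List.prod_cons, hv2]
    · rw [List.sum_cons, ← hw2, ← hv1, ← Multiset.coe_add, ← Multiset.cons_coe,
        ← Multiset.cons_coe]
      simp only [← Multiset.singleton_add]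
      abel

/-- A minimal product-one sequence: an atom of the monoid of product-one sequences. -/
structure IsMinimal (S : Multiset G) : Prop where
  isProductOne : IsProductOne S
  ne_zero : S ≠ 0
  eq_zero_or : ∀ A B, IsProductOne A → IsProductOne B → A + B = S → A = 0 ∨ B = 0

theorem IsMinimal.eq_of_add {A B S : Multiset G} (hS : IsMinimal S) (hA : IsProductOne A)
    (hB : IsProductOne B) (h : A + B = S) (hA0 : A ≠ 0) : S = A := by
  have := (hS.eq_zero_or A B hA hB h).resolve_left hA0
  rw [← h, this, add_zero]

theorem IsMinimal.card_pos {S : Multiset G} (hS : IsMinimal S) : 0 < S.card :=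
  Multiset.card_pos.2 hS.ne_zero

theorem IsMinimal.eq_singleton_one {S : Multiset G} (hS : IsMinimal S) (h : (1 : G) ∈ S) :
    S = {1} := by
  obtain ⟨l, rfl, hl⟩ := hS.isProductOne.exists_cons h
  refine hS.eq_of_add (isProductOne_singleton.2 rfl) (isProductOne_coe (l := l) ?_) ?_ (by simp)
  · simpa using hl
  · rw [← Multiset.cons_coe, Multiset.singleton_add]

/-- A product-one sequence of length two consists of an element and its inverse. -/
theorem IsProductOne.eq_pair {S : Multiset G} (hS : IsProductOne S) (h : S.card = 2) {g : G}
    (hg : g ∈ S) : S = {g, g⁻¹} := by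
  obtain ⟨l, rfl, hl⟩ := hS.exists_cons hg
  have hlen : l.length = 1 := by simpa using h
  obtain ⟨x, rfl⟩ := List.length_eq_one_iff.1 hlen
  have hx : x = g⁻¹ := by
    have : g * x = 1 := by simpa using hl
    exact eq_inv_of_mul_eq_one_right this
  subst hx
  rfl

theorem IsProductOne.two_le_card {S : Multiset G} (hS : IsProductOne S) (h : (1 : G) ∉ S)
    (h0 : S ≠ 0) : 2 ≤ S.card := by
  by_contra! hlt
  have h1 : S.card = 1 := by have := Multiset.card_pos.2 h0; omega
  obtain ⟨g, rfl⟩ := Multiset.card_eq_one.1 h1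
  have := isProductOne_singleton.1 hS
  simp [this] at h

theorem IsMinimal.two_le_card {S : Multiset G} (hS : IsMinimal S) (h : (1 : G) ∉ S) :
    2 ≤ S.card :=
  hS.isProductOne.two_le_card h hS.ne_zero

theorem isMinimal_of_card_le_three {S : Multiset G} (hS : IsProductOne S) (h1 : (1 : G) ∉ S)
    (h0 : S ≠ 0) (h3 : S.card ≤ 3) : IsMinimal S := by
  refine ⟨hS, h0, fun A B hA hB h => ?_⟩
  by_contra! hne
  subst h
  have hA2 := hA.two_le_card (fun h => h1 (by simp [h])) hne.1
  have hB2 := hB.two_le_card (fun h => h1 (by simp [h])) hne.2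
  rw [Multiset.card_add] at h3
  omega

theorem isMinimal_pair {g : G} (hg : g ≠ 1) : IsMinimal ({g, g⁻¹} : Multiset G) :=
  isMinimal_of_card_le_three (isProductOne_pair (by simp)) (by simp [hg, hg.symm]) (by simp)
    (by simp)

theorem isMinimal_pair_self {g : G} (hg : g ≠ 1) (hg2 : g * g = 1) :
    IsMinimal ({g, g} : Multiset G) :=
  isMinimal_of_card_le_three (isProductOne_pair hg2) (by simp [hg.symm]) (by simp) (by simp)

theorem isMinimal_replicate_orderOf {g : G} (h : 0 < orderOf g) :
    IsMinimal (Multiset.replicate (orderOf g) g) := by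
  refine ⟨isProductOne_replicate.2 (pow_orderOf_eq_one g), fun h0 => ?_, fun A B hA hB hAB => ?_⟩
  · have := congrArg Multiset.card h0
    rw [Multiset.card_replicate, Multiset.card_zero] at this
    omega
  · have hA' : A = Multiset.replicate A.card g := Multiset.eq_replicate_card.2 fun b hb =>
      Multiset.eq_of_mem_replicate (hAB ▸ Multiset.mem_add.2 (Or.inl hb))
    have hcard := congrArg Multiset.card hAB
    rw [Multiset.card_add, Multiset.card_replicate] at hcard
    rw [hA', isProductOne_replicate] at hA
    have hdvd := orderOf_dvd_of_pow_eq_one hA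
    rcases Nat.eq_zero_or_pos A.card with h0 | h0
    · exact Or.inl (Multiset.card_eq_zero.1 h0)
    · have := Nat.le_of_dvd h0 hdvd
      exact Or.inr (Multiset.card_eq_zero.1 (by omega))

/-- The partial products of a minimal product-one sequence, ordered with product one, are
pairwise distinct. -/
theorem IsMinimal.partial_prod_injective {l : List G} (hl : IsMinimal (l : Multiset G))
    (h1 : l.prod = 1) : Function.Injective fun i : Fin l.length => (l.take i).prod := by
  intro i j hij
  wlog hlt : i < j generalizing i j
  · rcases lt_or_eq_of_le (not_lt.1 hlt) with h | h
    · exact (this hij.symm h).symm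
    · exact h.symm
  exfalso
  have hi := i.2
  have hj := j.2
  have hlt' : (i : ℕ) < j := hlt
  have hab : l.take j = l.take i ++ (l.drop i).take (j - i) := by
    rw [← List.take_add]; congr 1; omega
  have habc : l.take i ++ (l.drop i).take (j - i) ++ l.drop j = l := by
    rw [← hab, List.take_append_drop]
  have hb1 : ((l.drop i).take (j - i)).prod = 1 := by
    have he : (l.take i).prod = (l.take j).prod := hij
    rw [hab, List.prod_append] at he
    simpa using he
  have hac : (l.take i ++ l.drop j).prod = 1 := by
    rw [← habc, List.prod_append, List.prod_append, hb1, mul_one] at h1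
    rw [List.prod_append, h1]
  rcases hl.eq_zero_or _ _ (isProductOne_coe hb1) (isProductOne_coe hac) (by
      conv_rhs => rw [← habc]
      rw [← Multiset.coe_add, ← Multiset.coe_add, ← Multiset.coe_add]
      abel) with h | h
  · have := congrArg Multiset.card h
    simp at this
    omega
  · have := congrArg Multiset.card h
    simp at this
    omega

/-- A minimal product-one sequence over a finite subgroup `K` has at most `|K|` terms. -/
theorem IsMinimal.card_le_subgroup {S : Multiset G} (hS : IsMinimal S) (K : Subgroup G) [Finite K]
    (hK : ∀ g ∈ S, g ∈ K) : S.card ≤ Nat.card K := by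
  obtain ⟨l, rfl, hl⟩ := hS.isProductOne
  have hinj := hS.partial_prod_injective hl
  have hmem : ∀ i : ℕ, (l.take i).prod ∈ K := fun i =>
    K.list_prod_mem fun x hx => hK x (Multiset.mem_coe.2 (List.mem_of_mem_take hx))
  have := Nat.card_le_card_of_injective
    (fun i : Fin l.length => (⟨(l.take i).prod, hmem i⟩ : K))
    (fun i j hij => hinj (congrArg Subtype.val hij))
  simpa using this

theorem IsMinimal.card_le [Finite G] {S : Multiset G} (hS : IsMinimal S) :
    S.card ≤ Nat.card G := by
  have := hS.card_le_subgroup (⊤ : Subgroup G) (by simp)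
  simpa using this

/-- The set of lengths of the factorizations of a sequence into minimal product-one sequences. -/
def lengthSet (S : Multiset G) : Set ℕ :=
  {k | ∃ z : Multiset (Multiset G), (∀ A ∈ z, IsMinimal A) ∧ z.sum = S ∧ z.card = k}

theorem IsMinimal.one_mem_lengthSet {A : Multiset G} (h : IsMinimal A) : 1 ∈ lengthSet A :=
  ⟨{A}, by simpa using h, by simp, by simp⟩

theorem isProductOne_of_mem_lengthSet {S : Multiset G} {k : ℕ} (h : k ∈ lengthSet S) :
    IsProductOne S := by
  obtain ⟨z, hz, rfl, -⟩ := h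
  exact isProductOne_sum fun A hA => (hz A hA).isProductOne

theorem add_mem_lengthSet {S T : Multiset G} {k l : ℕ} (hk : k ∈ lengthSet S)
    (hl : l ∈ lengthSet T) : k + l ∈ lengthSet (S + T) := by
  obtain ⟨z, hz, rfl, rfl⟩ := hk
  obtain ⟨y, hy, rfl, rfl⟩ := hl
  refine ⟨z + y, fun A hA => ?_, by simp, by simp⟩
  rcases Multiset.mem_add.1 hA with h | h
  · exact hz A h
  · exact hy A h

theorem nsmul_mem_lengthSet {S : Multiset G} {k : ℕ} (hk : k ∈ lengthSet S) (n : ℕ) :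
    n * k ∈ lengthSet (n • S) := by
  induction n with
  | zero => exact ⟨0, by simp, by simp, by simp⟩
  | succ n ih =>
    rw [succ_nsmul, Nat.succ_mul]
    exact add_mem_lengthSet ih hk

theorem card_le_card_sum {z : Multiset (Multiset G)} (h : ∀ A ∈ z, IsMinimal A) :
    z.card ≤ z.sum.card := by
  induction z using Multiset.induction_on with
  | empty => simp
  | cons A z ih =>
    have h1 := (h A (by simp)).card_pos
    have h2 := ih fun B hB => h B (by simp [hB])
    rw [Multiset.card_cons, Multiset.sum_cons, Multiset.card_add]
    omega

/-- Every product-one sequence is a product of minimal product-one sequences. -/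
theorem IsProductOne.exists_factorization {S : Multiset G} (hS : IsProductOne S) :
    ∃ z : Multiset (Multiset G), (∀ A ∈ z, IsMinimal A) ∧ z.sum = S := by
  induction hn : S.card using Nat.strong_induction_on generalizing S with
  | _ n ih =>
  by_cases h0 : S = 0
  · exact ⟨0, by simp, by simp [h0]⟩
  by_cases hmin : IsMinimal S
  · exact ⟨{S}, by simpa using hmin, by simp⟩
  have : ∃ A B, IsProductOne A ∧ IsProductOne B ∧ A + B = S ∧ A ≠ 0 ∧ B ≠ 0 := by
    by_contra! hcon
    exact hmin ⟨hS, h0, fun A B hA hB h => or_iff_not_imp_left.2 (hcon A B hA hB h)⟩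
  obtain ⟨A, B, hA, hB, rfl, hA0, hB0⟩ := this
  rw [Multiset.card_add] at hn
  have hA1 := Multiset.card_pos.2 hA0
  have hB1 := Multiset.card_pos.2 hB0
  obtain ⟨z, hz, hzs⟩ := ih A.card (by omega) hA rfl
  obtain ⟨y, hy, hys⟩ := ih B.card (by omega) hB rfl
  refine ⟨z + y, fun C hC => ?_, by simp [hzs, hys]⟩
  rcases Multiset.mem_add.1 hC with h | h
  · exact hz C h
  · exact hy C h

/-- `d` divides all differences of lengths of factorizations of sequences over `G₀`. -/
def DvdLengthDiffs (G₀ : Set G) (d : ℕ) : Prop :=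
  ∀ S : Multiset G, (∀ g ∈ S, g ∈ G₀) → ∀ k ∈ lengthSet S, ∀ l ∈ lengthSet S,
    (d : ℤ) ∣ (l : ℤ) - k

theorem DvdLengthDiffs.mono {G₀ G₁ : Set G} {d : ℕ} (h : DvdLengthDiffs G₁ d) (hsub : G₀ ⊆ G₁) :
    DvdLengthDiffs G₀ d :=
  fun S hS => h S fun g hg => hsub (hS g hg)

theorem DvdLengthDiffs.le_of_lt {G₀ : Set G} {d : ℕ} (h : DvdLengthDiffs G₀ d) {S : Multiset G}
    (hS : ∀ g ∈ S, g ∈ G₀) {k l : ℕ} (hk : k ∈ lengthSet S) (hl : l ∈ lengthSet S) (hkl : k < l) :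
    k + d ≤ l := by
  have := Int.le_of_dvd (by omega) (h S hS k hk l hl)
  omega

/-- An additive weight that takes the value `c` modulo `c * e` on all minimal product-one sequences
over `G₀` determines the lengths of factorizations modulo `e`. -/
theorem dvdLengthDiffs_of_weight {G₀ : Set G} {e : ℕ} (w : G → ℤ) (c : ℤ) (hc : c ≠ 0)
    (h : ∀ A : Multiset G, IsMinimal A → (∀ g ∈ A, g ∈ G₀) → c * e ∣ (A.map w).sum - c) :
    DvdLengthDiffs G₀ e := by
  have key : ∀ z : Multiset (Multiset G), (∀ A ∈ z, IsMinimal A) →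
      (∀ g ∈ z.sum, g ∈ G₀) → c * e ∣ (z.sum.map w).sum - c * z.card := by
    intro z
    induction z using Multiset.induction_on with
    | empty => simp
    | cons A z ih =>
      intro hz hs
      rw [Multiset.sum_cons] at hs
      have h1 := h A (hz A (by simp)) fun g hg => hs g (by simp [hg])
      have h2 := ih (fun B hB => hz B (by simp [hB])) fun g hg => hs g (by simp [hg])
      have h3 := dvd_add h1 h2
      rw [Multiset.sum_cons, Multiset.map_add, Multiset.sum_add, Multiset.card_cons]
      rwa [show (A.map w).sum + (z.sum.map w).sum - c * ((z.card + 1 : ℕ) : ℤ)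
        = (A.map w).sum - c + ((z.sum.map w).sum - c * z.card) by push_cast; ring]
  rintro S hS k ⟨z, hz, rfl, rfl⟩ l ⟨y, hy, hyz, rfl⟩
  have h1 := key z hz hS
  have h2 := key y hy (hyz ▸ hS)
  rw [hyz] at h2
  have h3 := dvd_sub h1 h2
  rw [show (z.sum.map w).sum - c * z.card - ((z.sum.map w).sum - c * y.card)
    = c * ((y.card : ℤ) - z.card) by ring] at h3
  exact (mul_dvd_mul_iff_left hc).1 h3

end Sequences

/-! ### Divisor-closed submonoids -/

section Submonoids

variable {G : Type*} [Group G]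

/-- The underlying sequence of an element of a submonoid of the monoid of product-one sequences. -/
def toSeq {S : Submonoid (productOneMonoid G)} (a : S) : Multiset G :=
  Multiplicative.toAdd ((a : productOneMonoid G) : Multiplicative (Multiset G))

variable {S : Submonoid (productOneMonoid G)}

theorem toSeq_injective : Function.Injective (toSeq (S := S)) := fun _ _ h =>
  Subtype.ext (Subtype.ext (Multiplicative.toAdd.injective h))

theorem toSeq_mul (a b : S) : toSeq (a * b) = toSeq a + toSeq b := rfl

theorem toSeq_one : toSeq (1 : S) = 0 := rfl

theorem toSeq_prod (z : Multiset S) : toSeq z.prod = (z.map toSeq).sum := by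
  induction z using Multiset.induction_on with
  | empty => simp [toSeq_one]
  | cons a z ih => rw [Multiset.prod_cons, toSeq_mul, ih, Multiset.map_cons, Multiset.sum_cons]

theorem isProductOne_toSeq (a : S) : IsProductOne (toSeq a) := (a : productOneMonoid G).2

/-- The element of the monoid of product-one sequences given by a product-one sequence. -/
def IsProductOne.toElement {A : Multiset G} (h : IsProductOne A) : productOneMonoid G :=
  ⟨Multiplicative.ofAdd A, h⟩

theorem eq_one_of_isUnit {a : S} (h : IsUnit a) : a = 1 := by
  have h1 : IsUnit (a : productOneMonoid G) := h.map S.subtype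
  rw [isUnit_iff_size] at h1
  exact toSeq_injective (Multiset.card_eq_zero.1 h1)

theorem associates_mk_injective : Function.Injective (Associates.mk (M := S)) := by
  intro a b h
  obtain ⟨u, hu⟩ := Associates.mk_eq_mk_iff_associated.1 h
  rw [← hu, eq_one_of_isUnit u.isUnit, mul_one]

theorem associates_irreducible_mk_iff (a : S) : Irreducible (Associates.mk a) ↔ Irreducible a :=
  MulEquiv.irreducible_iff (x := a) (MulEquiv.ofBijective (Associates.mkMonoidHom (M := S))
    ⟨associates_mk_injective, Associates.mk_surjective⟩)

/-- In a divisor-closed submonoid the atoms are the minimal product-one sequences. -/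
theorem irreducible_iff_isMinimal (hS : IsDivisorClosed S) (a : S) :
    Irreducible a ↔ IsMinimal (toSeq a) := by
  constructor
  · intro h
    refine ⟨isProductOne_toSeq a, fun h0 => ?_, fun A B hA hB hAB => ?_⟩
    · have : a = 1 := toSeq_injective h0
      exact h.not_isUnit (this ▸ isUnit_one)
    · have hmul : hA.toElement * hB.toElement = (a : productOneMonoid G) :=
        Subtype.ext (Multiplicative.toAdd.injective hAB)
      have hAS := hS _ _ a.2 ⟨_, hmul.symm⟩
      have hBS := hS _ _ a.2 ⟨_, (mul_comm _ _).trans hmul |>.symm⟩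
      have := h.isUnit_or_isUnit (a := ⟨_, hAS⟩) (b := ⟨_, hBS⟩) (Subtype.ext hmul.symm)
      refine this.imp (fun h => ?_) (fun h => ?_)
      · exact (congrArg toSeq (eq_one_of_isUnit h)).trans toSeq_one
      · exact (congrArg toSeq (eq_one_of_isUnit h)).trans toSeq_one
  · intro h
    refine ⟨fun hu => h.ne_zero (by rw [eq_one_of_isUnit hu, toSeq_one]), fun b c hbc => ?_⟩
    have := h.eq_zero_or _ _ (isProductOne_toSeq b) (isProductOne_toSeq c) (by rw [hbc, toSeq_mul])
    refine this.imp (fun h => ?_) (fun h => ?_)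
    · rw [show b = 1 from toSeq_injective h]; exact isUnit_one
    · rw [show c = 1 from toSeq_injective h]; exact isUnit_one

theorem exists_multiset_map_eq {α β : Type*} (f : α → β) (z : Multiset β)
    (h : ∀ b ∈ z, ∃ a, f a = b) : ∃ y : Multiset α, y.map f = z := by
  induction z using Multiset.induction_on with
  | empty => exact ⟨0, by simp⟩
  | cons b z ih =>
    obtain ⟨a, rfl⟩ := h b (by simp)
    obtain ⟨y, rfl⟩ := ih fun c hc => h c (by simp [hc])
    exact ⟨a ::ₘ y, by simp⟩

theorem lengths_eq_lengthSet (hS : IsDivisorClosed S) (a : S) :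
    lengths a = lengthSet (toSeq a) := by
  ext k
  constructor
  · rintro ⟨z, hz, hprod, rfl⟩
    obtain ⟨y, rfl⟩ := exists_multiset_map_eq Associates.mk z fun b _ => Associates.mk_surjective b
    rw [Associates.prod_mk] at hprod
    refine ⟨y.map toSeq, fun A hA => ?_, ?_, by simp⟩
    · obtain ⟨u, hu, rfl⟩ := Multiset.mem_map.1 hA
      rw [← irreducible_iff_isMinimal hS, ← associates_irreducible_mk_iff]
      exact hz _ (Multiset.mem_map_of_mem _ hu)
    · rw [← toSeq_prod, associates_mk_injective hprod]
  · rintro ⟨z, hz, hsum, rfl⟩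
    obtain ⟨y, rfl⟩ := exists_multiset_map_eq (toSeq (S := S)) z fun A hA => by
      obtain ⟨y, rfl⟩ := Multiset.exists_cons_of_mem hA
      rw [Multiset.sum_cons] at hsum
      have hA1 := (hz A hA).isProductOne
      have hy1 : IsProductOne y.sum := isProductOne_sum fun B hB =>
        (hz B (by simp [hB])).isProductOne
      have hmul : (a : productOneMonoid G) = hA1.toElement * hy1.toElement :=
        Subtype.ext (Multiplicative.toAdd.injective hsum.symm)
      exact ⟨⟨hA1.toElement, hS _ _ a.2 ⟨_, hmul⟩⟩, rfl⟩
    refine ⟨y.map Associates.mk, fun u hu => ?_, ?_, by simp⟩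
    · obtain ⟨b, hb, rfl⟩ := Multiset.mem_map.1 hu
      rw [associates_irreducible_mk_iff, irreducible_iff_isMinimal hS]
      exact hz _ (Multiset.mem_map_of_mem _ hb)
    · rw [Associates.prod_mk, toSeq_injective ((toSeq_prod y).trans hsum)]

/-- The submonoid of product-one sequences over a subset `G₀` of `G`. -/
def productOneOver (G₀ : Set G) : Submonoid (productOneMonoid G) where
  carrier := {S | ∀ g ∈ Multiplicative.toAdd (S : Multiplicative (Multiset G)), g ∈ G₀}
  one_mem' := fun g hg => absurd hg (Multiset.notMem_zero g)
  mul_mem' := fun hS hT g hg => (Multiset.mem_add.1 hg).elim (hS g) (hT g)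

theorem isDivisorClosed_productOneOver (G₀ : Set G) : IsDivisorClosed (productOneOver G₀) := by
  rintro a _ hb ⟨c, rfl⟩ g hg
  exact hb g (Multiset.mem_add.2 (Or.inl hg))

/-- A divisor-closed submonoid contains every product-one sequence over the set of terms of its
members: such a sequence divides a product of members, one for each of its terms. -/
theorem IsDivisorClosed.mem_of_isProductOne (hS : IsDivisorClosed S) {A : Multiset G}
    (hA : IsProductOne A) (h : ∀ g ∈ A, ∃ B : S, g ∈ toSeq B) : hA.toElement ∈ S := by
  choose! f hf using h
  obtain ⟨l, rfl, hl⟩ := id hA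
  obtain ⟨w, hw, hsum⟩ := exists_complement (l := l) (V := l.map fun g => toSeq (f g))
    (by
      rw [List.forall₂_map_right_iff, List.forall₂_same]
      exact fun g hg => hf g (Multiset.mem_coe.2 hg))
    (by
      intro T hT
      obtain ⟨g, -, rfl⟩ := List.mem_map.1 hT
      exact isProductOne_toSeq _)
  rw [hl, one_mul] at hw
  refine hS _ _ (l.map f).prod.2 ⟨(isProductOne_coe hw).toElement, ?_⟩
  refine Subtype.ext (Multiplicative.toAdd.injective (Eq.trans ?_ hsum.symm))
  have := toSeq_prod ((l.map f : List S) : Multiset S)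
  rw [Multiset.prod_coe, Multiset.map_coe, Multiset.sum_coe, List.map_map] at this
  exact this

theorem exists_mem_distances_le {L : Set ℕ} {k l : ℕ} (hk : k ∈ L) (hl : l ∈ L) (hkl : k < l) :
    ∃ e ∈ distances L, e ≤ l - k := by
  classical
  have hex : ∃ m, k < m ∧ m ∈ L := ⟨l, hkl, hl⟩
  obtain ⟨h1, h2⟩ := Nat.find_spec hex
  have hle : Nat.find hex ≤ l := Nat.find_min' hex ⟨hkl, hl⟩
  refine ⟨Nat.find hex - k, ⟨by omega, k, hk, ?_⟩, by omega⟩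
  rw [Nat.add_sub_cancel' h1.le]
  ext m
  simp only [Set.mem_inter_iff, Set.mem_Icc, Set.mem_insert_iff, Set.mem_singleton_iff]
  constructor
  · rintro ⟨hm, hkm, hml⟩
    by_contra! hne
    exact Nat.find_min hex (lt_of_le_of_ne hml hne.2) ⟨lt_of_le_of_ne hkm hne.1.symm, hm⟩
  · rintro (rfl | rfl)
    · exact ⟨hk, le_rfl, h1.le⟩
    · exact ⟨h2, h1.le, le_rfl⟩

/-- The minimal distances of the monoid of product-one sequences. The divisor-closed submonoids
are the monoids of product-one sequences over subsets `G₀`, and the minimal distance of such a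
monoid is the greatest common divisor of all differences of lengths. -/
theorem mem_deltaStar_iff {d : ℕ} :
    d ∈ deltaStar G ↔ 0 < d ∧ ∃ G₀ : Set G, DvdLengthDiffs G₀ d ∧
      ∃ A : Multiset G, (∀ g ∈ A, g ∈ G₀) ∧ ∃ k, k ∈ lengthSet A ∧ k + d ∈ lengthSet A := by
  constructor
  · rintro ⟨S, hS, hd, hmin⟩
    obtain ⟨_, ⟨a, rfl⟩, hd0, k, hk, hL⟩ := hd
    have hkd : k + d ∈ lengths a := by
      have : k + d ∈ lengths a ∩ Set.Icc k (k + d) := by rw [hL]; simp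
      exact this.1
    rw [lengths_eq_lengthSet hS] at hk hkd
    refine ⟨hd0, {g | ∃ B : S, g ∈ toSeq B}, ?_, toSeq a, fun g hg => ⟨a, hg⟩, k, hk, hkd⟩
    intro A hA m hm l hl
    wlog hml : m ≤ l generalizing m l
    · rw [← neg_sub, Int.dvd_neg]
      exact this l hl m hm (by omega)
    rw [← Nat.cast_sub hml, Int.natCast_dvd_natCast]
    by_contra hnd
    -- With `l - m = q * d + r` and `0 < r < d`, the product of `A` with the `q`-th power of `a`
    -- has two lengths that differ by `r`.
    have hr0 : 0 < (l - m) % d := Nat.pos_of_ne_zero fun h => hnd (Nat.dvd_of_mod_eq_zero h)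
    have hrd : (l - m) % d < d := Nat.mod_lt _ hd0
    have hdm := Nat.div_add_mod' (l - m) d
    set q := (l - m) / d
    have h1 := add_mem_lengthSet (nsmul_mem_lengthSet hkd q) hm
    have h2 := add_mem_lengthSet (nsmul_mem_lengthSet hk q) hl
    have hAS := hS.mem_of_isProductOne (isProductOne_of_mem_lengthSet hm) hA
    set b : S := a ^ q * ⟨_, hAS⟩ with hb
    have hbs : toSeq b = q • toSeq a + A := rfl
    rw [← hbs, ← lengths_eq_lengthSet hS] at h1 h2
    rw [Nat.mul_add] at h1
    obtain ⟨e, he, hele⟩ := exists_mem_distances_le h1 h2 (by omega)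
    have := hmin (Set.mem_iUnion.2 ⟨b, he⟩)
    omega
  · rintro ⟨hd, G₀, hG, A, hA, k, hk, hkd⟩
    have hS := isDivisorClosed_productOneOver G₀
    refine ⟨productOneOver G₀, hS, Set.mem_iUnion.2
      ⟨⟨(isProductOne_of_mem_lengthSet hk).toElement, hA⟩, hd, k, ?_, ?_⟩, ?_⟩
    · rw [lengths_eq_lengthSet hS]; exact hk
    · rw [lengths_eq_lengthSet hS]
      change lengthSet A ∩ _ = _
      ext m
      simp only [Set.mem_inter_iff, Set.mem_Icc, Set.mem_insert_iff, Set.mem_singleton_iff]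
      constructor
      · rintro ⟨hm, hkm, hml⟩
        rcases hkm.eq_or_lt with h | h
        · exact Or.inl h.symm
        · have := hG.le_of_lt hA hk hm h
          exact Or.inr (by omega)
      · rintro (rfl | rfl)
        · exact ⟨hk, le_rfl, by omega⟩
        · exact ⟨hkd, by omega, le_rfl⟩
    · intro e he
      obtain ⟨b, he0, m, hm, hL⟩ := Set.mem_iUnion.1 he
      have hme : m + e ∈ lengths b := by
        have : m + e ∈ lengths b ∩ Set.Icc m (m + e) := by rw [hL]; simp
        exact this.1
      rw [lengths_eq_lengthSet hS] at hm hme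
      have := hG.le_of_lt b.2 hm hme (by omega)
      omega

theorem irreducible_iff_isMinimal_toAdd (a : productOneMonoid G) :
    Irreducible a ↔ IsMinimal (Multiplicative.toAdd (a : Multiplicative (Multiset G))) := by
  have hS : IsDivisorClosed (⊤ : Submonoid (productOneMonoid G)) := fun _ _ _ _ => trivial
  rw [← MulEquiv.irreducible_iff (Submonoid.topEquiv (M := productOneMonoid G)).symm,
    irreducible_iff_isMinimal hS]
  rfl

theorem mem_atomSizes_iff {k : ℕ} :
    k ∈ atomSizes G ↔ ∃ A : Multiset G, IsMinimal A ∧ A.card = k := by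
  constructor
  · rintro ⟨a, ha, rfl⟩
    exact ⟨_, (irreducible_iff_isMinimal_toAdd a).1 ha, rfl⟩
  · rintro ⟨A, hA, rfl⟩
    exact ⟨hA.isProductOne.toElement, (irreducible_iff_isMinimal_toAdd _).2 hA, rfl⟩

theorem IsMinimal.card_le_davenport [Finite G] {A : Multiset G} (hA : IsMinimal A) :
    A.card ≤ davenport G :=
  (isGreatest_davenport G).2 (mem_atomSizes_iff.2 ⟨A, hA, rfl⟩)

theorem davenport_le_card [Finite G] : davenport G ≤ Nat.card G :=
  atomSizes_le G (isGreatest_davenport G).1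

end Submonoids

section Injective

theorem sum_map_map {α β : Type*} (f : α → β) (z : Multiset (Multiset α)) :
    (z.map (Multiset.map f)).sum = z.sum.map f := by
  induction z using Multiset.induction_on with
  | empty => simp
  | cons A z ih => simp [ih]

variable {G H : Type*} [Group G] [Group H] {f : G →* H}

theorem isProductOne_map_iff (hf : Function.Injective f) {S : Multiset G} :
    IsProductOne (S.map f) ↔ IsProductOne S := by
  constructor
  · rintro ⟨l, hl, h1⟩
    obtain ⟨m, rfl⟩ : ∃ m : List G, m.map f = l := by
      have : ∀ x ∈ l, x ∈ Set.range f := fun x hx => by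
        rw [← Multiset.mem_coe, hl] at hx
        obtain ⟨g, -, rfl⟩ := Multiset.mem_map.1 hx
        exact ⟨g, rfl⟩
      rw [← Set.mem_range, Set.range_list_map]
      exact this
    rw [← Multiset.map_coe] at hl
    refine ⟨m, Multiset.map_injective hf hl, hf ?_⟩
    rw [map_list_prod, h1, map_one]
  · rintro ⟨l, rfl, h1⟩
    exact ⟨l.map f, by simp, by rw [← map_list_prod, h1, map_one]⟩

theorem isMinimal_map_iff (hf : Function.Injective f) {S : Multiset G} :
    IsMinimal (S.map f) ↔ IsMinimal S := by
  constructor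
  · intro h
    refine ⟨(isProductOne_map_iff hf).1 h.isProductOne, fun h0 => h.ne_zero (by simp [h0]),
      fun A B hA hB hAB => ?_⟩
    have := h.eq_zero_or (A.map f) (B.map f) ((isProductOne_map_iff hf).2 hA)
      ((isProductOne_map_iff hf).2 hB) (by rw [← Multiset.map_add, hAB])
    simpa using this
  · intro h
    refine ⟨(isProductOne_map_iff hf).2 h.isProductOne, by simpa using h.ne_zero,
      fun A B hA hB hAB => ?_⟩
    have hmem : ∀ x ∈ A + B, ∃ g, f g = x := fun x hx => by
      rw [hAB] at hx
      obtain ⟨g, -, rfl⟩ := Multiset.mem_map.1 hx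
      exact ⟨g, rfl⟩
    obtain ⟨A, rfl⟩ := exists_multiset_map_eq f A fun x hx => hmem x (by simp [hx])
    obtain ⟨B, rfl⟩ := exists_multiset_map_eq f B fun x hx => hmem x (by simp [hx])
    rw [← Multiset.map_add] at hAB
    have := h.eq_zero_or A B ((isProductOne_map_iff hf).1 hA) ((isProductOne_map_iff hf).1 hB)
      (Multiset.map_injective hf hAB)
    simpa using this

theorem lengthSet_map (hf : Function.Injective f) (S : Multiset G) :
    lengthSet (S.map f) = lengthSet S := by
  ext k
  constructor
  · rintro ⟨z, hz, hsum, rfl⟩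
    obtain ⟨y, rfl⟩ := exists_multiset_map_eq (Multiset.map f) z fun A hA => by
      refine (exists_multiset_map_eq f A fun x hx => ?_)
      have : x ∈ S.map f := hsum ▸ Multiset.mem_of_le (Multiset.single_le_sum (by simp) A hA) hx
      obtain ⟨g, -, rfl⟩ := Multiset.mem_map.1 this
      exact ⟨g, rfl⟩
    refine ⟨y, fun A hA => (isMinimal_map_iff hf).1 (hz _ (Multiset.mem_map_of_mem _ hA)),
      Multiset.map_injective hf ?_, by simp⟩
    rw [← hsum, sum_map_map]
  · rintro ⟨z, hz, rfl, rfl⟩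
    refine ⟨z.map (Multiset.map f), fun A hA => ?_, sum_map_map f z, by simp⟩
    obtain ⟨B, hB, rfl⟩ := Multiset.mem_map.1 hA
    exact (isMinimal_map_iff hf).2 (hz B hB)

theorem deltaStar_subset_of_injective (hf : Function.Injective f) :
    deltaStar G ⊆ deltaStar H := by
  intro d hd
  rw [mem_deltaStar_iff] at hd ⊢
  obtain ⟨hd0, G₀, hG, A, hA, k, hk, hkd⟩ := hd
  refine ⟨hd0, f '' G₀, fun S hS => ?_, A.map f, ?_, k, ?_⟩
  · obtain ⟨T, rfl⟩ := exists_multiset_map_eq f S fun x hx =>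
      let ⟨g, _, h⟩ := hS x hx
      ⟨g, h⟩
    rw [lengthSet_map hf]
    refine hG T fun g hg => ?_
    obtain ⟨g', hg', h⟩ := hS (f g) (Multiset.mem_map_of_mem f hg)
    exact hf h ▸ hg'
  · intro x hx
    obtain ⟨g, hg, rfl⟩ := Multiset.mem_map.1 hx
    exact ⟨g, hA g hg, rfl⟩
  · rw [lengthSet_map hf]
    exact ⟨hk, hkd⟩

theorem deltaStar_congr (e : G ≃* H) : deltaStar G = deltaStar H :=
  (deltaStar_subset_of_injective (f := e.toMonoidHom) e.injective).antisymm
    (deltaStar_subset_of_injective (f := e.symm.toMonoidHom) e.symm.injective)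

theorem davenport_le_of_injective [Finite G] [Finite H] (hf : Function.Injective f) :
    davenport G ≤ davenport H := by
  obtain ⟨A, hA, h⟩ := mem_atomSizes_iff.1 (isGreatest_davenport G).1
  have := ((isMinimal_map_iff hf).2 hA).card_le_davenport
  rwa [Multiset.card_map, h] at this

end Injective

/-! ### Exchange relations and the bound by the large Davenport constant -/

section Extraction

theorem count_sum_le {G : Type*} [DecidableEq G] {D : ℕ} (g : G) (z : Multiset (Multiset G))
    (h : ∀ A ∈ z, A.card ≤ D) : z.sum.count g ≤ D * z.card := by
  induction z using Multiset.induction_on with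
  | empty => simp
  | cons A z ih =>
    have h1 := (Multiset.count_le_card g A).trans (h A (by simp))
    have h2 := ih fun B hB => h B (by simp [hB])
    rw [Multiset.sum_cons, Multiset.count_add, Multiset.card_cons, Nat.mul_succ]
    omega

theorem exists_mem_of_mem_sum {G : Type*} {z : Multiset (Multiset G)} {g : G} (h : g ∈ z.sum) :
    ∃ A ∈ z, g ∈ A := by
  induction z using Multiset.induction_on with
  | empty => simp at h
  | cons A z ih =>
    rw [Multiset.sum_cons, Multiset.mem_add] at h
    rcases h with h | h
    · exact ⟨A, by simp, h⟩
    · obtain ⟨B, hB, hg⟩ := ih h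
      exact ⟨B, by simp [hB], hg⟩

/-- If every term of `l` occurs often enough in a sum of short sequences, then different summands
can be chosen for the different terms of `l`. -/
theorem exists_distinct_summands {G : Type*} [DecidableEq G] {D : ℕ} (z : Multiset (Multiset G))
    (h : ∀ A ∈ z, A.card ≤ D) (l : List G) (hl : ∀ g ∈ l, D * l.length < z.sum.count g + D) :
    ∃ V : List (Multiset G), List.Forall₂ (fun g S => g ∈ S) l V ∧ (V : Multiset _) ≤ z := by
  induction l with
  | nil => exact ⟨[], .nil, by simp⟩
  | cons g l ih =>
    rw [List.length_cons] at hl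
    obtain ⟨V, hV, hVz⟩ := ih fun x hx => by
      have := hl x (by simp [hx])
      rw [Nat.mul_succ] at this
      omega
    obtain ⟨y, rfl⟩ := Multiset.le_iff_exists_add.1 hVz
    have h1 := count_sum_le g (V : Multiset (Multiset G)) fun A hA => h A (by simp [hA])
    rw [Multiset.coe_card, ← hV.length_eq] at h1
    have h2 := hl g (by simp)
    rw [Multiset.sum_add, Multiset.count_add, Nat.mul_succ] at h2
    have h3 : g ∈ y.sum := Multiset.count_pos.1 (by omega)
    obtain ⟨A, hA, hgA⟩ := exists_mem_of_mem_sum h3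
    refine ⟨A :: V, hV.cons hgA, ?_⟩
    rw [← Multiset.cons_coe, ← Multiset.singleton_add, add_comm]
    exact add_le_add_right (Multiset.singleton_le.2 hA) _

variable {G : Type*} [Group G]

/-- An exchange relation over `G₀`: the minimal product-one sequence `U` is extracted from
the product of minimal product-one sequences `V`, one for each term of `U`, and `z` is
a factorization of what remains. -/
structure ExchangeRelation (G₀ : Set G) (U : Multiset G) (V : List (Multiset G))
    (z : Multiset (Multiset G)) : Prop where
  isMinimal : IsMinimal U
  mem_of_mem : ∀ S ∈ V, ∀ g ∈ S, g ∈ G₀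
  isMinimal_source : ∀ S ∈ V, IsMinimal S
  isMinimal_rest : ∀ S ∈ z, IsMinimal S
  terms : ∃ l : List G, (l : Multiset G) = U ∧ List.Forall₂ (fun g S => g ∈ S) l V
  sum_eq : V.sum = U + z.sum

theorem ExchangeRelation.length_eq {G₀ : Set G} {U : Multiset G} {V : List (Multiset G)}
    {z : Multiset (Multiset G)} (h : ExchangeRelation G₀ U V z) : V.length = U.card := by
  obtain ⟨l, rfl, hl⟩ := h.terms
  rw [← hl.length_eq, Multiset.coe_card]

/-- If exchange relations never shorten factorizations, then `U` can be extracted from any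
factorization in which its terms are frequent, at the cost of at most one factor. -/
theorem exists_extraction [DecidableEq G] {G₀ : Set G} {D : ℕ}
    (hD : ∀ A : Multiset G, IsMinimal A → (∀ g ∈ A, g ∈ G₀) → A.card ≤ D)
    (hex : ∀ U V z, ExchangeRelation G₀ U V z → U.card ≤ z.card + 1)
    {U B : Multiset G} (hU : IsMinimal U) {x : Multiset (Multiset G)} (hx : ∀ A ∈ x, IsMinimal A)
    (hover : ∀ g ∈ U + B, g ∈ G₀) (hsum : x.sum = U + B)
    (hcount : ∀ g ∈ U, D * D < (U + B).count g + D) :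
    ∃ y : Multiset (Multiset G), (∀ A ∈ y, IsMinimal A) ∧ y.sum = B ∧ x.card ≤ y.card + 1 := by
  have hxover : ∀ A ∈ x, ∀ g ∈ A, g ∈ G₀ := fun A hA g hg =>
    hover g (hsum ▸ Multiset.mem_of_le (Multiset.single_le_sum (by simp) A hA) hg)
  obtain ⟨l, hlU, hl1⟩ := hU.isProductOne
  have hlen : l.length ≤ D := by
    have := hD U hU fun g hg => hover g (by simp [hg])
    rwa [← hlU, Multiset.coe_card] at this
  obtain ⟨V, hV, hVx⟩ := exists_distinct_summands x (fun A hA => hD A (hx A hA) (hxover A hA)) l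
    fun g hg => by
      have h1 := hcount g (hlU ▸ Multiset.mem_coe.2 hg)
      have h2 := Nat.mul_le_mul_left D hlen
      rw [hsum]
      omega
  obtain ⟨y, rfl⟩ := Multiset.le_iff_exists_add.1 hVx
  have hVmin : ∀ S ∈ V, IsMinimal S := fun S hS => hx S (by simp [hS])
  obtain ⟨w, hw1, hw2⟩ := exists_complement hV fun S hS => (hVmin S hS).isProductOne
  rw [hl1, one_mul] at hw1
  obtain ⟨z, hz, hzs⟩ := (isProductOne_coe hw1).exists_factorization
  have hrel : ExchangeRelation G₀ U V z :=
    ⟨hU, fun S hS => hxover S (by simp [hS]), hVmin, hz, ⟨l, hlU, hV⟩, by rw [← hw2, hlU, hzs]⟩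
  refine ⟨z + y, fun A hA => ?_, ?_, ?_⟩
  · rcases Multiset.mem_add.1 hA with h | h
    · exact hz A h
    · exact hx A (by simp [h])
  · rw [Multiset.sum_add, Multiset.sum_coe, hrel.sum_eq, add_assoc] at hsum
    rw [Multiset.sum_add]
    exact add_left_cancel hsum
  · have h1 := hex U V z hrel
    have h2 := hrel.length_eq
    simp only [Multiset.card_add, Multiset.coe_card]
    omega

/-- If exchange relations never shorten factorizations, then all factorizations of a sequence have
the same length: from a high power of a factorization `x` the factors of another factorization
`y` can be extracted one by one until only boundedly many terms remain. -/
theorem card_le_of_exchange [DecidableEq G] {G₀ : Set G} {D : ℕ}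
    (hD : ∀ A : Multiset G, IsMinimal A → (∀ g ∈ A, g ∈ G₀) → A.card ≤ D)
    (hex : ∀ U V z, ExchangeRelation G₀ U V z → U.card ≤ z.card + 1)
    {S : Multiset G} (hS : ∀ g ∈ S, g ∈ G₀) {k l : ℕ} (hk : k ∈ lengthSet S)
    (hl : l ∈ lengthSet S) : l ≤ k := by
  have key : ∀ (y : Multiset (Multiset G)) (B : Multiset G) (x : Multiset (Multiset G)),
      (∀ A ∈ y, IsMinimal A) → (∀ A ∈ x, IsMinimal A) → x.sum = y.sum + B →
      (∀ g ∈ y.sum + B, g ∈ G₀) → (∀ g ∈ y.sum, D * D < B.count g + D) →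
      ∃ x' : Multiset (Multiset G), (∀ A ∈ x', IsMinimal A) ∧ x'.sum = B ∧
        x.card ≤ x'.card + y.card := by
    intro y
    induction y using Multiset.induction_on with
    | empty => exact fun B x _ hx hsum _ _ => ⟨x, hx, by simpa using hsum, by simp⟩
    | cons U y ih =>
      intro B x hy hx hsum hover hcount
      rw [Multiset.sum_cons] at hsum hover hcount
      rw [add_assoc] at hsum hover
      obtain ⟨x₁, hx₁, hsum₁, hcard₁⟩ := exists_extraction hD hex (hy U (by simp)) hx hover hsum
        fun g hg => by
          have := hcount g (by simp [hg])
          simp only [Multiset.count_add]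
          omega
      obtain ⟨x', hx', hsum', hcard'⟩ := ih B x₁ (fun A hA => hy A (by simp [hA])) hx₁ hsum₁
        (fun g hg => hover g (by simpa using Or.inr (by simpa using hg)))
        fun g hg => hcount g (by simp [hg])
      exact ⟨x', hx', hsum', by rw [Multiset.card_cons]; omega⟩
  obtain ⟨y, hy, rfl, rfl⟩ := hk
  obtain ⟨x, hx, hxy, rfl⟩ := hl
  by_contra! hlt
  -- Extract `y` from a power of `x` so often that the bounded remainder cannot matter.
  set N := (D * D + 1) * y.sum.card + 1 with hN
  have hmem : ∀ {n : ℕ} {A : Multiset G} {z : Multiset (Multiset G)}, A ∈ n • z → A ∈ z :=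
    fun h => Multiset.mem_of_mem_nsmul h
  obtain ⟨x', hx', hsum', hcard'⟩ := key (N • y) ((D * D + 1) • y.sum) ((N + (D * D + 1)) • x)
    (fun A hA => hy A (hmem hA)) (fun A hA => hx A (hmem hA))
    (by rw [Multiset.sum_nsmul, Multiset.sum_nsmul, hxy, add_nsmul])
    (fun g hg => by
      rw [Multiset.sum_nsmul, ← add_nsmul] at hg
      exact hS g (Multiset.mem_of_mem_nsmul hg))
    (fun g hg => by
      rw [Multiset.sum_nsmul] at hg
      have h1 := Multiset.count_pos.2 (Multiset.mem_of_mem_nsmul hg)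
      rw [Multiset.count_nsmul]
      have := Nat.mul_le_mul_left (D * D + 1) h1
      omega)
  have hle := card_le_card_sum hx'
  rw [hsum', Multiset.card_nsmul] at hle
  rw [Multiset.card_nsmul, Multiset.card_nsmul] at hcard'
  have h1 : N * (y.card + 1) ≤ N * x.card := Nat.mul_le_mul_left N hlt
  rw [Nat.add_mul] at hcard'
  rw [Nat.mul_add, mul_one] at h1
  omega

/-- An exchange relation that shortens a factorization must, when the lengths are determined
modulo `d`, shorten it by at least `d`. As the rest is not empty, this needs an extracted sequence
with at least `d + 2` terms, and if none is longer, then the rest is a single minimal sequence;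
then all sources have only two terms. -/
theorem exists_long_isMinimal [Finite G] {G₀ : Set G} {d : ℕ} (hd : 0 < d)
    (hG : DvdLengthDiffs G₀ d) {S : Multiset G} (hS : ∀ g ∈ S, g ∈ G₀) {k : ℕ}
    (hk : k ∈ lengthSet S) (hkd : k + d ∈ lengthSet S) :
    ∃ U : Multiset G, IsMinimal U ∧ (∀ g ∈ U, g ∈ G₀) ∧ d + 2 ≤ U.card ∧
      ((∀ A : Multiset G, IsMinimal A → (∀ g ∈ A, g ∈ G₀) → A.card ≤ d + 2) →
        ∀ g ∈ U, g⁻¹ ∈ G₀) := by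
  classical
  obtain ⟨U, V, z, hrel, hlt⟩ : ∃ U V z, ExchangeRelation G₀ U V z ∧ z.card + 1 < U.card := by
    by_contra! hcon
    have := card_le_of_exchange (D := Nat.card G) (fun A hA _ => hA.card_le) hcon hS hk hkd
    omega
  have hVover : ∀ g ∈ V.sum, g ∈ G₀ := fun g hg => by
    rw [← Multiset.sum_coe] at hg
    obtain ⟨A, hA, hgA⟩ := exists_mem_of_mem_sum hg
    exact hrel.mem_of_mem A hA g hgA
  have hUover : ∀ g ∈ U, g ∈ G₀ := fun g hg => hVover g (by rw [hrel.sum_eq]; simp [hg])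
  have h1U : (1 : G) ∉ U := fun h => by
    have := hrel.isMinimal.eq_singleton_one h
    rw [this, Multiset.card_singleton] at hlt
    omega
  obtain ⟨l, hlU, hl⟩ := hrel.terms
  have hV2 : ∀ A ∈ V, 2 ≤ A.card := by
    intro A hA
    obtain ⟨i, hi, rfl⟩ := List.getElem_of_mem hA
    have hmem : l[i]'(hl.length_eq ▸ hi) ∈ V[i] := hl.get _ hi
    refine (hrel.isMinimal_source _ hA).two_le_card fun h => ?_
    rw [(hrel.isMinimal_source _ hA).eq_singleton_one h, Multiset.mem_singleton] at hmem
    exact h1U (hlU ▸ Multiset.mem_coe.2 (hmem ▸ List.getElem_mem _))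
  have hVlen := hrel.length_eq
  have hVcard : V.sum.card = (V.map Multiset.card).sum :=
    map_list_sum Multiset.cardHom V
  have hcardsum : V.sum.card = U.card + z.sum.card := by rw [hrel.sum_eq, Multiset.card_add]
  have hVge : 2 * V.length ≤ V.sum.card := by
    rw [hVcard, mul_comm, ← smul_eq_mul, ← List.length_map (as := V) (f := Multiset.card)]
    exact List.card_nsmul_le_sum _ _ fun c hc => by
      obtain ⟨A, hA, rfl⟩ := List.mem_map.1 hc
      exact hV2 A hA
  have hz0 : 0 < z.card := by
    rw [Multiset.card_pos]
    rintro rfl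
    simp at hcardsum
    omega
  have hstep := hG.le_of_lt hVover (k := z.card + 1) (l := U.card)
    ⟨U ::ₘ z, fun A hA => by
      rcases Multiset.mem_cons.1 hA with rfl | h
      · exact hrel.isMinimal
      · exact hrel.isMinimal_rest A h, by rw [Multiset.sum_cons, hrel.sum_eq], by simp⟩
    ⟨(V : Multiset _), fun A hA => hrel.isMinimal_source A hA, by simp, by simpa using hVlen⟩ hlt
  refine ⟨U, hrel.isMinimal, hUover, by omega, fun hmax g hg => ?_⟩
  have hUmax := hmax U hrel.isMinimal hUover
  obtain ⟨W, rfl⟩ := Multiset.card_eq_one.1 (show z.card = 1 by omega)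
  rw [Multiset.sum_singleton] at hcardsum
  have hWmax := hmax W (hrel.isMinimal_rest W (by simp)) fun x hx =>
    hVover x (by rw [hrel.sum_eq]; simp [hx])
  obtain ⟨i, hi, rfl⟩ := List.getElem_of_mem (Multiset.mem_coe.1 (hlU ▸ hg : g ∈ (l : Multiset G)))
  have hi' : i < V.length := hl.length_eq ▸ hi
  have hmem : l[i] ∈ V[i] := hl.get hi hi'
  have hVi : V[i] ∈ V := List.getElem_mem hi'
  -- All members of `V` have at least two terms and together they have at most `2 * |V|`.
  have hcard2 : V[i].card = 2 := by
    refine le_antisymm ?_ (hV2 _ hVi)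
    by_contra! h3
    have : (V.map fun _ => 2).sum < (V.map Multiset.card).sum :=
      List.sum_lt_sum _ _ (fun A hA => hV2 A hA) ⟨V[i], hVi, h3⟩
    rw [← hVcard, List.map_const', List.sum_replicate, smul_eq_mul] at this
    omega
  have := (hrel.isMinimal_source _ hVi).isProductOne.eq_pair hcard2 hmem
  exact hrel.mem_of_mem _ hVi _ (by rw [this]; simp)

theorem le_davenport_of_mem_deltaStar [Finite G] {d : ℕ} (h : d ∈ deltaStar G) :
    d + 2 ≤ davenport G := by
  obtain ⟨hd, G₀, hG, A, hA, k, hk, hkd⟩ := mem_deltaStar_iff.1 h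
  obtain ⟨U, hU, -, hcard, -⟩ := exists_long_isMinimal hd hG hA hk hkd
  exact hcard.trans hU.card_le_davenport

end Extraction

/-! ### Minimal distances from elements and involutions -/

section Elements

variable {G : Type*} [Group G]

theorem one_mem_deltaStar_of_lengths {S : Multiset G} {k : ℕ} (hk : k ∈ lengthSet S)
    (hk1 : k + 1 ∈ lengthSet S) : 1 ∈ deltaStar G :=
  mem_deltaStar_iff.2 ⟨one_pos, Set.univ, fun _ _ _ _ _ _ => by simp, S, fun _ _ => trivial,
    k, hk, hk1⟩

theorem one_mem_deltaStar [Finite G] (hG : 3 ≤ Nat.card G) : 1 ∈ deltaStar G := by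
  by_cases h : ∃ g : G, g ^ 2 ≠ 1
  · obtain ⟨g, hg2⟩ := h
    have hg : g ≠ 1 := by rintro rfl; simp at hg2
    have hA : IsMinimal ({g, g, (g ^ 2)⁻¹} : Multiset G) :=
      isMinimal_of_card_le_three ⟨[g, g, (g ^ 2)⁻¹], rfl, by simp [pow_two, ← mul_assoc]⟩
        (by simp [hg.symm, eq_comm (a := (1 : G)), hg2]) (by simp) (by simp)
    have hB : IsMinimal ({g⁻¹, g⁻¹, g ^ 2} : Multiset G) :=
      isMinimal_of_card_le_three ⟨[g⁻¹, g⁻¹, g ^ 2], rfl, by simp [pow_two]⟩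
        (by simp [hg, hg2.symm, eq_comm (a := (1 : G))]) (by simp) (by simp)
    have h1 := isMinimal_pair hg
    have h2 := isMinimal_pair hg2
    refine one_mem_deltaStar_of_lengths (k := 2)
      (add_mem_lengthSet hA.one_mem_lengthSet hB.one_mem_lengthSet) ?_
    have := add_mem_lengthSet (add_mem_lengthSet h1.one_mem_lengthSet h1.one_mem_lengthSet)
      h2.one_mem_lengthSet
    convert this using 1
    simp only [Multiset.insert_eq_cons, ← Multiset.singleton_add]
    abel_nf
  · push Not at h
    have := Fintype.ofFinite G
    rw [Nat.card_eq_fintype_card] at hG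
    obtain ⟨a, ha⟩ := Fintype.exists_ne_of_one_lt_card (by omega) (1 : G)
    classical
    obtain ⟨b, hb⟩ : ∃ b : G, b ∉ ({1, a} : Finset G) := by
      by_contra! hcon
      have h1 := Finset.card_le_card (fun b _ => hcon b : Finset.univ ⊆ ({1, a} : Finset G))
      have h2 := Finset.card_le_two (a := (1 : G)) (b := a)
      rw [Finset.card_univ] at h1
      omega
    simp only [Finset.mem_insert, Finset.mem_singleton, not_or] at hb
    have hsq : ∀ x : G, x * x = 1 := fun x => by rw [← pow_two, h]
    have hab : a * b ≠ 1 := fun h0 => hb.2 (by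
      rw [← mul_left_cancel_iff (a := a), h0, hsq])
    have hA : IsMinimal ({a, b, a * b} : Multiset G) :=
      isMinimal_of_card_le_three ⟨[a, b, a * b], rfl, by
        have := hsq (a * b)
        simpa [← mul_assoc] using this⟩
        (by
          simp only [Multiset.insert_eq_cons, Multiset.mem_cons, Multiset.mem_singleton, not_or]
          exact ⟨ha.symm, Ne.symm hb.1, hab.symm⟩) (by simp) (by simp)
    refine one_mem_deltaStar_of_lengths (k := 2)
      (add_mem_lengthSet hA.one_mem_lengthSet hA.one_mem_lengthSet) ?_
    have := add_mem_lengthSet (add_mem_lengthSet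
      (isMinimal_pair_self ha (hsq a)).one_mem_lengthSet
      (isMinimal_pair_self hb.1 (hsq b)).one_mem_lengthSet)
      (isMinimal_pair_self hab (hsq _)).one_mem_lengthSet
    convert this using 1
    simp only [Multiset.insert_eq_cons, ← Multiset.singleton_add]
    abel_nf

theorem nsmul_pair {G : Type*} (n : ℕ) (g h : G) :
    n • ({g, h} : Multiset G) = Multiset.replicate n g + Multiset.replicate n h := by
  rw [Multiset.insert_eq_cons, ← Multiset.singleton_add, nsmul_add, Multiset.nsmul_singleton,
    Multiset.nsmul_singleton]

/-- The identity `gⁿ · (g⁻¹)ⁿ = (g · g⁻¹)ⁿ` with `n = ord g`, in terms of lengths. -/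
theorem orderOf_relation {g : G} (h : 2 ≤ orderOf g) :
    2 ∈ lengthSet (orderOf g • ({g, g⁻¹} : Multiset G)) ∧
      orderOf g ∈ lengthSet (orderOf g • ({g, g⁻¹} : Multiset G)) := by
  have hg : g ≠ 1 := by
    rintro rfl
    simp at h
  constructor
  · rw [nsmul_pair]
    have h1 := isMinimal_replicate_orderOf (g := g) (by omega)
    have h2 := isMinimal_replicate_orderOf (g := g⁻¹) (by rw [orderOf_inv]; omega)
    rw [orderOf_inv] at h2
    exact add_mem_lengthSet h1.one_mem_lengthSet h2.one_mem_lengthSet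
  · simpa using nsmul_mem_lengthSet (isMinimal_pair hg).one_mem_lengthSet (orderOf g)

theorem isMinimal_over_inv {g : G} {A : Multiset G} (hA : IsMinimal A)
    (h : ∀ x ∈ A, x ∈ ({g, g⁻¹} : Set G)) :
    A = {g, g⁻¹} ∨ A = Multiset.replicate (orderOf g) g ∨
      A = Multiset.replicate (orderOf g) g⁻¹ := by
  classical
  have hone : ∀ x : G, (∀ y ∈ A, y = x) → A = Multiset.replicate (orderOf x) x := by
    intro x hx
    have hrep : A = Multiset.replicate A.card x := Multiset.eq_replicate_card.2 hx
    have h1 := hA.isProductOne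
    rw [hrep, isProductOne_replicate] at h1
    have hdvd := orderOf_dvd_of_pow_eq_one h1
    have hle := Nat.le_of_dvd hA.card_pos hdvd
    have hpos : 0 < orderOf x := Nat.pos_of_dvd_of_pos hdvd hA.card_pos
    refine hA.eq_of_add (isProductOne_replicate.2 (pow_orderOf_eq_one x))
      (B := Multiset.replicate (A.card - orderOf x) x) ?_ ?_ ?_
    · rw [isProductOne_replicate, pow_sub _ hle, h1, pow_orderOf_eq_one, inv_one, mul_one]
    · rw [← Multiset.replicate_add, Nat.add_sub_cancel' hle, ← hrep]
    · intro h0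
      have := congrArg Multiset.card h0
      simp only [Multiset.card_replicate, Multiset.card_zero] at this
      omega
  by_cases hg : g ∈ A
  · by_cases hg' : g⁻¹ ∈ A
    · by_cases hgg : g⁻¹ = g
      · exact Or.inr (Or.inl (hone g fun y hy => by simpa [hgg] using h y hy))
      left
      obtain ⟨B, rfl⟩ := Multiset.exists_cons_of_mem hg
      obtain ⟨C, rfl⟩ := Multiset.exists_cons_of_mem
        ((Multiset.mem_cons.1 hg').resolve_left hgg)
      refine hA.eq_of_add (isProductOne_pair (by simp)) (B := C) ?_ (by
        simp only [Multiset.insert_eq_cons, ← Multiset.singleton_add]; abel) (by simp)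
      obtain ⟨l, hl, hl1⟩ := hA.isProductOne
      refine ⟨(l.erase g).erase g⁻¹, ?_, ?_⟩
      · rw [← Multiset.coe_erase, ← Multiset.coe_erase, hl, Multiset.erase_cons_head,
          Multiset.erase_cons_head]
      · have hperm : l.Perm (g :: g⁻¹ :: (l.erase g).erase g⁻¹) := by
          have h1 : g ∈ l := by rw [← Multiset.mem_coe, hl]; simp
          have h2 : g⁻¹ ∈ l.erase g := by
            rw [← Multiset.mem_coe, ← Multiset.coe_erase, hl, Multiset.erase_cons_head]; simp
          exact (List.perm_cons_erase h1).trans ((List.perm_cons_erase h2).cons g)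
        have hcomm : (l.Pairwise Commute) := by
          refine List.pairwise_of_forall_mem_list fun x hx y hy => ?_
          rw [← Multiset.mem_coe, hl] at hx hy
          have h1 := h x hx
          have h2 := h y hy
          simp only [Set.mem_insert_iff, Set.mem_singleton_iff] at h1 h2
          rcases h1 with rfl | rfl <;> rcases h2 with rfl | rfl <;> simp [Commute, SemiconjBy]
        have := hperm.prod_eq' hcomm
        rw [hl1] at this
        simpa using this.symm
    · refine Or.inr (Or.inl (hone g fun y hy => ?_))
      rcases h y hy with rfl | h
      · rfl
      · exact absurd (Set.mem_singleton_iff.1 h ▸ hy) hg'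
  · refine Or.inr (Or.inr ?_)
    rw [← orderOf_inv]
    refine hone g⁻¹ fun y hy => ?_
    rcases h y hy with rfl | h
    · exact absurd hy hg
    · exact h

theorem orderOf_sub_two_mem_deltaStar {g : G} (h : 3 ≤ orderOf g) :
    orderOf g - 2 ∈ deltaStar G := by
  classical
  obtain ⟨h2, hn⟩ := orderOf_relation (g := g) (by omega)
  have hne : g⁻¹ ≠ g := fun h0 => by
    have : g ^ 2 = 1 := by rw [pow_two, ← mul_inv_cancel g, h0]
    have := Nat.le_of_dvd two_pos (orderOf_dvd_of_pow_eq_one this)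
    omega
  refine mem_deltaStar_iff.2 ⟨by omega, {g, g⁻¹}, ?_, _, fun x hx => ?_, 2, h2, ?_⟩
  · -- The weights `1` and `n - 1` take the values `n`, `n` and `n * (n - 1)` on the three atoms.
    refine dvdLengthDiffs_of_weight (fun x => if x = g then 1 else (orderOf g : ℤ) - 1) (orderOf g)
      (by omega) fun A hA hAG => ?_
    obtain ⟨m, hm⟩ : ∃ m, orderOf g = m + 2 := ⟨orderOf g - 2, by omega⟩
    rcases isMinimal_over_inv hA hAG with rfl | rfl | rfl
    · simp [hne]
    · simp
    · simp only [Multiset.map_replicate, hne, if_false, Multiset.sum_replicate, hm]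
      exact ⟨1, by push_cast [nsmul_eq_mul]; ring⟩
  · have := Multiset.mem_of_mem_nsmul hx
    simpa using this
  · rwa [show 2 + (orderOf g - 2) = orderOf g by omega]

/-- If `h` is not a power of `g`, then `gⁿ⁻¹ · h · (h⁻¹ g)` with `n = ord g` is a minimal
product-one sequence: both parts of a decomposition would be in `⟨g⟩`. -/
theorem orderOf_lt_davenport [Finite G] {g h : G} (hh : h ∉ Subgroup.zpowers g) :
    orderOf g < davenport G := by
  classical
  have hn : 0 < orderOf g := orderOf_pos g
  have hh' : h⁻¹ * g ∉ Subgroup.zpowers g := fun h0 => by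
    rw [Subgroup.mul_mem_cancel_right _ (Subgroup.mem_zpowers g), inv_mem_iff] at h0
    exact hh h0
  -- A product-one sequence containing just one of the two terms outside `⟨g⟩` is impossible.
  have hsingle : ∀ (x : G) (C : Multiset G), x ∉ Subgroup.zpowers g →
      (∀ y ∈ C, y = g) → ¬ IsProductOne (x ::ₘ C) := by
    intro x C hx hC h1
    obtain ⟨l, hl, hl1⟩ := h1.exists_cons (Multiset.mem_cons_self x C)
    rw [← Multiset.cons_coe, Multiset.cons_inj_right] at hl
    refine hx ?_
    have : x = l.prod⁻¹ := eq_inv_of_mul_eq_one_left (by simpa using hl1)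
    rw [this, inv_mem_iff]
    exact Subgroup.list_prod_mem _ fun y hy => by
      rw [hC y (hl ▸ Multiset.mem_coe.2 hy)]; exact Subgroup.mem_zpowers g
  have hpow : ∀ C : Multiset G, C ≤ Multiset.replicate (orderOf g - 1) g → IsProductOne C →
      C = 0 := by
    intro C hC h1
    have hrep : C = Multiset.replicate C.card g := Multiset.eq_replicate_card.2 fun y hy =>
      Multiset.eq_of_mem_replicate (Multiset.mem_of_le hC hy)
    have hcard := Multiset.card_le_card hC
    rw [Multiset.card_replicate] at hcard
    rw [hrep, isProductOne_replicate] at h1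
    have := orderOf_dvd_of_pow_eq_one h1
    rw [← Multiset.card_eq_zero]
    exact Nat.eq_zero_of_dvd_of_lt this (by omega)
  have main : ∀ A B : Multiset G, IsProductOne A → IsProductOne B →
      A + B = h ::ₘ (h⁻¹ * g) ::ₘ Multiset.replicate (orderOf g - 1) g → h ∈ A → B = 0 := by
    intro A B hA hB hAB hmem
    obtain ⟨A, rfl⟩ := Multiset.exists_cons_of_mem hmem
    rw [Multiset.cons_add, Multiset.cons_inj_right] at hAB
    have hx : h⁻¹ * g ∈ A + B := by rw [hAB]; simp
    rcases Multiset.mem_add.1 hx with hx | hx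
    · obtain ⟨A, rfl⟩ := Multiset.exists_cons_of_mem hx
      rw [Multiset.cons_add, Multiset.cons_inj_right] at hAB
      exact hpow B (hAB.symm ▸ Multiset.le_add_left B A) hB
    · obtain ⟨B, rfl⟩ := Multiset.exists_cons_of_mem hx
      rw [Multiset.add_cons, Multiset.cons_inj_right] at hAB
      refine absurd hA (hsingle h A hh fun y hy => ?_)
      exact Multiset.eq_of_mem_replicate (hAB ▸ Multiset.mem_add.2 (Or.inl hy))
  have hS : IsMinimal (h ::ₘ (h⁻¹ * g) ::ₘ Multiset.replicate (orderOf g - 1) g) := by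
    refine ⟨⟨h :: (h⁻¹ * g) :: List.replicate (orderOf g - 1) g, ?_, ?_⟩, by simp,
      fun A B hA hB hAB => ?_⟩
    · rw [← Multiset.coe_replicate, Multiset.cons_coe, Multiset.cons_coe]
    · rw [List.prod_cons, List.prod_cons, List.prod_replicate, ← mul_assoc, mul_inv_cancel_left,
        ← pow_succ', Nat.sub_add_cancel hn, pow_orderOf_eq_one]
    · have : h ∈ A + B := by rw [hAB]; simp
      rcases Multiset.mem_add.1 this with hA' | hB'
      · exact Or.inr (main A B hA hB hAB hA')
      · exact Or.inl (main B A hB hA (by rw [add_comm, hAB]) hB')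
  have := hS.card_le_davenport
  simp only [Multiset.card_cons, Multiset.card_replicate] at this
  omega

/-- If the minimal distance `D(G) - 2` occurs in a noncyclic group, then there is a minimal
product-one sequence of the maximal length `D(G)` whose terms all have order two. -/
theorem exists_isMinimal_involutions [Finite G] (hG : ¬ IsCyclic G) {d : ℕ}
    (hd : d + 2 = davenport G) (h : d ∈ deltaStar G) :
    ∃ (G₀ : Set G) (U : Multiset G), DvdLengthDiffs G₀ d ∧ IsMinimal U ∧ (∀ g ∈ U, g ∈ G₀) ∧
      U.card = d + 2 ∧ ∀ g ∈ U, orderOf g = 2 := by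
  obtain ⟨hd0, G₀, hG₀, A, hA, k, hk, hkd⟩ := mem_deltaStar_iff.1 h
  obtain ⟨U, hU, hUG, hcard, hinv⟩ := exists_long_isMinimal hd0 hG₀ hA hk hkd
  have hU1 : (1 : G) ∉ U := fun h1 => by
    rw [hU.eq_singleton_one h1, Multiset.card_singleton] at hcard
    omega
  refine ⟨G₀, U, hG₀, hU, hUG, le_antisymm (hd ▸ hU.card_le_davenport) hcard, fun g hg => ?_⟩
  have hne : orderOf g ≠ 1 := fun h1 => hU1 (orderOf_eq_one_iff.1 h1 ▸ hg)
  have hpos := orderOf_pos g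
  by_contra h2
  obtain ⟨hr2, hrn⟩ := orderOf_relation (g := g) (by omega)
  have hle := hG₀.le_of_lt (fun x hx => by
    have hx := Multiset.mem_of_mem_nsmul hx
    simp only [Multiset.insert_eq_cons, Multiset.mem_cons, Multiset.mem_singleton] at hx
    rcases hx with rfl | rfl
    · exact hUG _ hg
    · exact hinv (fun A hA _ => hd ▸ hA.card_le_davenport) g hg) hr2 hrn (by omega)
  refine hG ⟨g, fun x => ?_⟩
  by_contra hx
  have := orderOf_lt_davenport hx
  omega

theorem isCyclic_or_exists_subgroup [Finite G]
    (h : IsGreatest (deltaStar G) (davenport G - 2)) :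
    IsCyclic G ∨ ∃ G₁ : Subgroup G, davenport G₁ = davenport G ∧
      Subgroup.closure {g : G | g ∈ G₁ ∧ orderOf g = 2} = G₁ := by
  by_cases hG : IsCyclic G
  · exact Or.inl hG
  refine Or.inr ?_
  have hpos := (mem_deltaStar_iff.1 h.1).1
  obtain ⟨G₀, U, -, hU, -, hcard, hord⟩ := exists_isMinimal_involutions hG (by omega) h.1
  let K := Subgroup.closure {g : G | g ∈ U}
  refine ⟨K, le_antisymm (davenport_le_of_injective K.subtype_injective) ?_, ?_⟩
  · obtain ⟨W, hW⟩ := exists_multiset_map_eq K.subtype U fun g hg =>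
      ⟨⟨g, Subgroup.subset_closure hg⟩, rfl⟩
    rw [← hW] at hU hcard
    have := ((isMinimal_map_iff K.subtype_injective).1 hU).card_le_davenport
    rw [Multiset.card_map] at hcard
    omega
  · refine le_antisymm ((Subgroup.closure_le _).2 fun g hg => hg.1) ?_
    refine (Subgroup.closure_le _).2 fun g hg => Subgroup.subset_closure ?_
    exact ⟨Subgroup.subset_closure hg, hord g hg⟩

end Elements

section Involutions

variable {G : Type*} [Group G]

theorem even_count_sum {G : Type*} [DecidableEq G] {z : Multiset (Multiset G)} {g : G}
    (h : ∀ A ∈ z, Even (A.count g)) : Even (z.sum.count g) := by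
  induction z using Multiset.induction_on with
  | empty => simp
  | cons A z ih =>
    rw [Multiset.sum_cons, Multiset.count_add]
    exact (h A (by simp)).add (ih fun B hB => h B (by simp [hB]))

/-- A product-one sequence of involutions with an odd multiplicity has at least `d + 2` terms. It
has a minimal factor `A` other than the sequences `g · g`; as `A · A` is a product of `|A|`
sequences of the form `g · g`, the number `d` divides `|A| - 2`. -/
theorem DvdLengthDiffs.le_card_of_odd_count [DecidableEq G] {G₀ : Set G} {d : ℕ}
    (hG : DvdLengthDiffs G₀ d) {S : Multiset G} (hS : IsProductOne S) (hSG : ∀ g ∈ S, g ∈ G₀)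
    (h1 : (1 : G) ∉ S) (hinv : ∀ g ∈ S, g * g = 1) {g : G} (hg : Odd (S.count g)) :
    d + 2 ≤ S.card := by
  obtain ⟨z, hz, rfl⟩ := hS.exists_factorization
  obtain ⟨A, hA, hodd⟩ : ∃ A ∈ z, Odd (A.count g) := by
    by_contra! hcon
    exact Nat.not_even_iff_odd.2 hg (even_count_sum fun A hA => Nat.not_odd_iff_even.1 (hcon A hA))
  have hAle : A ≤ z.sum := Multiset.single_le_sum (by simp) A hA
  have hmem : ∀ {x}, x ∈ A → x ∈ z.sum := fun hx => Multiset.mem_of_le hAle hx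
  have hA2 := (hz A hA).two_le_card fun h => h1 (hmem h)
  have hgA : g ∈ A := Multiset.count_pos.1 hodd.pos
  have hne2 : A.card ≠ 2 := fun h2 => by
    rw [(hz A hA).isProductOne.eq_pair h2 hgA,
      inv_eq_of_mul_eq_one_right (hinv g (hmem hgA))] at hodd
    simp [Nat.odd_iff] at hodd
  have hsq : A.card ∈ lengthSet (A + A) := by
    refine ⟨A.map fun x => {x, x}, fun B hB => ?_, ?_, by simp⟩
    · obtain ⟨x, hx, rfl⟩ := Multiset.mem_map.1 hB
      exact isMinimal_pair_self (fun h => h1 (hmem (h ▸ hx))) (hinv x (hmem hx))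
    · simp only [Multiset.insert_eq_cons, ← Multiset.singleton_add, Multiset.sum_map_add,
        Multiset.sum_map_singleton]
  have := hG.le_of_lt (fun x hx => hSG x (hmem ((Multiset.mem_add.1 hx).elim id id)))
    (add_mem_lengthSet (hz A hA).one_mem_lengthSet (hz A hA).one_mem_lengthSet) hsq (by omega)
  have := Multiset.card_le_card hAle
  omega

/-- A sequence over involutions in which every multiplicity is even is product-one. -/
theorem isProductOne_of_even_count [DecidableEq G] {S : Multiset G} (hinv : ∀ g ∈ S, g * g = 1)
    (h : ∀ g, Even (S.count g)) : IsProductOne S := by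
  rw [← Multiset.toFinset_sum_count_nsmul_eq S]
  refine isProductOne_sum (z := S.toFinset.val.map fun g => S.count g • {g}) fun A hA => ?_
  obtain ⟨g, hg, rfl⟩ := Multiset.mem_map.1 hA
  obtain ⟨c, hc⟩ := h g
  rw [hc, Multiset.nsmul_singleton, isProductOne_replicate, ← two_mul, pow_mul, pow_two,
    hinv g (by simpa using hg), one_pow]

/-- A minimal product-one sequence over involutions that is not a square `g · g` has a term of odd
multiplicity. -/
theorem IsMinimal.exists_odd_count [DecidableEq G] {S : Multiset G} (hS : IsMinimal S)
    (hinv : ∀ g ∈ S, g * g = 1) (h3 : 3 ≤ S.card) : ∃ g, Odd (S.count g) := by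
  by_contra! hcon
  have hev : ∀ g, Even (S.count g) := fun g => Nat.not_odd_iff_even.1 (hcon g)
  obtain ⟨g, hg⟩ := Multiset.exists_mem_of_ne_zero hS.ne_zero
  have h2 : 2 ≤ S.count g := by
    have := Multiset.count_pos.2 hg
    have := hev g
    rw [Nat.even_iff] at this
    omega
  obtain ⟨T, rfl⟩ := Multiset.le_iff_exists_add.1
    (show ({g, g} : Multiset G) ≤ S from Multiset.le_count_iff_replicate_le.1 h2)
  have := hS.eq_of_add (isProductOne_pair (hinv g hg)) (B := T)
    (isProductOne_of_even_count (fun x hx => hinv x (by simp [hx])) fun x => ?_) rfl (by simp)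
  · rw [this] at h3
    simp at h3
  · have h1 := hev x
    rw [Multiset.count_add, Nat.even_add] at h1
    refine h1.1 ?_
    rw [Multiset.insert_eq_cons, Multiset.count_cons, Multiset.count_singleton]
    split_ifs <;> simp

end Involutions

/-! ### Groups with a minimal distance of `|G| - 2` -/

section DihedralRecognition

variable {G : Type*} [Group G]

theorem mul_zpow_of_involutions {a b : G} (ha : a * a = 1) (hb : b * b = 1) (k : ℤ) :
    (a * b) ^ k * a = a * (a * b) ^ (-k) := by
  have ha' : a⁻¹ = a := inv_eq_of_mul_eq_one_right ha
  have hb' : b⁻¹ = b := inv_eq_of_mul_eq_one_right hb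
  have h : SemiconjBy a (a * b) (a * b)⁻¹ := by
    rw [SemiconjBy, mul_inv_rev, ha', hb', ← mul_assoc, ha, one_mul, mul_assoc, ha, mul_one]
  have := h.zpow_right (-k)
  rw [inv_zpow, zpow_neg, inv_inv, ← zpow_neg] at this
  exact this.symm

/-- A product of involutions `a`, `b` is a power of `a * b` or `a` times such a power. -/
theorem exists_zpow_of_list_prod {a b : G} (ha : a * a = 1) (hb : b * b = 1) (l : List G)
    (hl : ∀ x ∈ l, x = a ∨ x = b) :
    ∃ k : ℤ, l.prod = (a * b) ^ k ∨ l.prod = a * (a * b) ^ k := by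
  have hb' : b = a * (a * b) := by rw [← mul_assoc, ha, one_mul]
  induction l with
  | nil => exact ⟨0, by simp⟩
  | cons x l ih =>
    obtain ⟨k, hk⟩ := ih fun y hy => hl y (by simp [hy])
    rw [List.prod_cons]
    rcases hl x (by simp) with rfl | rfl
    · refine ⟨k, hk.symm.imp (fun h => ?_) (fun h => ?_)⟩
      · rw [h, ← mul_assoc, ha, one_mul]
      · rw [h]
    · rcases hk with h | h
      · refine ⟨1 + k, Or.inr ?_⟩
        rw [h, zpow_add, zpow_one, ← mul_assoc, ← hb']
      · refine ⟨-1 + k, Or.inl ?_⟩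
        have := mul_zpow_of_involutions ha hb (-1)
        rw [zpow_add, h, ← mul_assoc]
        congr 1
        rw [zpow_neg, zpow_one, mul_inv_rev, inv_eq_of_mul_eq_one_right ha,
          inv_eq_of_mul_eq_one_right hb]

/-- A finite noncyclic group whose elements are products of two involutions `a`, `b` is dihedral. -/
theorem exists_mulEquiv_dihedralGroup [Finite G] {a b : G} (ha : a * a = 1) (hb : b * b = 1)
    (hgen : ∀ g : G, ∃ l : List G, (∀ x ∈ l, x = a ∨ x = b) ∧ l.prod = g) (hG : ¬ IsCyclic G) :
    Nonempty (G ≃* DihedralGroup (orderOf (a * b))) := by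
  set x := a * b with hx
  have hpos : 0 < orderOf x := orderOf_pos x
  have : NeZero (orderOf x) := ⟨hpos.ne'⟩
  have hall : ∀ g : G, ∃ k : ℤ, g = x ^ k ∨ g = a * x ^ k := fun g => by
    obtain ⟨l, hl, rfl⟩ := hgen g
    exact exists_zpow_of_list_prod ha hb l hl
  have haZ : ∀ k : ℤ, a ≠ x ^ k := fun k hk => hG ⟨x, fun g => by
    obtain ⟨m, rfl | rfl⟩ := hall g
    · exact Subgroup.zpow_mem_zpowers x m
    · exact ⟨k + m, by rw [hk, ← zpow_add]⟩⟩
  -- Exponents of `x` are residues modulo `ord x`.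
  have hpow : ∀ (i : ZMod (orderOf x)) (k : ℤ), (k : ZMod (orderOf x)) = i →
      x ^ (i.val : ℤ) = x ^ k := fun i k hk => by
    rw [zpow_eq_zpow_iff_modEq, ← ZMod.intCast_eq_intCast_iff, hk, Int.cast_natCast,
      ZMod.natCast_val, ZMod.cast_id]
  have hval : ∀ i : ZMod (orderOf x), ((i.val : ℤ) : ZMod (orderOf x)) = i := fun i => by
    rw [Int.cast_natCast, ZMod.natCast_val, ZMod.cast_id]
  have hinj : ∀ i j : ZMod (orderOf x), x ^ (i.val : ℤ) = x ^ (j.val : ℤ) → i = j :=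
    fun i j h => by
      rw [zpow_eq_zpow_iff_modEq, ← ZMod.intCast_eq_intCast_iff, hval, hval] at h
      exact h
  have hcomm : ∀ k : ℤ, x ^ k * a = a * x ^ (-k) := mul_zpow_of_involutions ha hb
  let φ : DihedralGroup (orderOf x) →* G := MonoidHom.mk'
    (fun | .r i => x ^ (i.val : ℤ) | .sr i => a * x ^ (i.val : ℤ)) (by
      rintro (i | i) (j | j)
      · change x ^ _ = x ^ _ * x ^ _
        rw [← zpow_add]
        exact hpow _ _ (by rw [Int.cast_add, hval, hval])
      · change a * x ^ _ = x ^ _ * (a * x ^ _)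
        rw [← mul_assoc, hcomm, mul_assoc, ← zpow_add]
        rw [hpow _ (-(i.val : ℤ) + j.val) (by rw [Int.cast_add, Int.cast_neg, hval, hval]; ring)]
      · change a * x ^ _ = a * x ^ _ * x ^ _
        rw [mul_assoc, ← zpow_add]
        rw [hpow _ ((i.val : ℤ) + j.val) (by rw [Int.cast_add, hval, hval])]
      · change x ^ _ = a * x ^ _ * (a * x ^ _)
        rw [mul_assoc, ← mul_assoc (x ^ _), hcomm, mul_assoc, ← mul_assoc a, ha, one_mul,
          ← zpow_add]
        rw [hpow _ (-(i.val : ℤ) + j.val) (by rw [Int.cast_add, Int.cast_neg, hval, hval]; ring)])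
  refine ⟨(MulEquiv.ofBijective φ ⟨?_, fun g => ?_⟩).symm⟩
  · rintro (i | i) (j | j) h
    · exact congrArg _ (hinj i j h)
    · change x ^ (i.val : ℤ) = a * x ^ (j.val : ℤ) at h
      exact absurd (eq_mul_inv_of_mul_eq h.symm) (by rw [← zpow_neg, ← zpow_add]; exact haZ _)
    · change a * x ^ (i.val : ℤ) = x ^ (j.val : ℤ) at h
      exact absurd (eq_mul_inv_of_mul_eq h) (by rw [← zpow_neg, ← zpow_add]; exact haZ _)
    · exact congrArg _ (hinj i j (mul_left_cancel h))
  · obtain ⟨k, rfl | rfl⟩ := hall g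
    · exact ⟨.r k, hpow _ k rfl⟩
    · exact ⟨.sr k, congrArg (a * ·) (hpow _ k rfl)⟩

/-- In an alternating list the numbers of occurrences of the two letters differ by at most one. -/
theorem count_le_count_of_isChain {α : Type*} [DecidableEq α] {a b : α} (hab : a ≠ b)
    (l : List α) (hl : ∀ x ∈ l, x = a ∨ x = b) (hchain : l.IsChain (· ≠ ·)) :
    l.count a + l.count b = l.length ∧ l.count a ≤ l.count b + 1 ∧ l.count b ≤ l.count a + 1 ∧
      (l.head? = some a → l.count b ≤ l.count a) ∧ (l.head? = some b → l.count a ≤ l.count b) := by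
  induction l with
  | nil => simp
  | cons x l ih =>
    obtain ⟨h0, h1, h2, h3, h4⟩ := ih (fun y hy => hl y (by simp [hy])) hchain.tail
    have hhead : l.head? = none ∨ ∃ y, l.head? = some y ∧ x ≠ y ∧ (y = a ∨ y = b) := by
      cases l with
      | nil => simp
      | cons y l =>
        rw [List.isChain_cons_cons] at hchain
        exact Or.inr ⟨y, rfl, hchain.1, hl y (by simp)⟩
    rcases hl x (by simp) with rfl | rfl
    · have h5 : l.count x ≤ l.count b := by
        rcases hhead with h | ⟨y, h, hne, rfl | rfl⟩
        · simp [List.head?_eq_none_iff.1 h]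
        · exact absurd rfl hne
        · exact h4 h
      simp only [List.count_cons_self, List.count_cons_of_ne hab, List.head?_cons,
        Option.some.injEq]
      exact ⟨by rw [List.length_cons]; omega, by omega, by omega, fun _ => by omega,
        fun h => absurd h hab⟩
    · have h5 : l.count x ≤ l.count a := by
        rcases hhead with h | ⟨y, h, hne, rfl | rfl⟩
        · simp [List.head?_eq_none_iff.1 h]
        · exact h3 h
        · exact absurd rfl hne
      simp only [List.count_cons_self, List.count_cons_of_ne hab.symm, List.head?_cons,
        Option.some.injEq]
      exact ⟨by rw [List.length_cons]; omega, by omega, by omega,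
        fun h => absurd h hab.symm, fun _ => by omega⟩

/-- Suppose that a minimal product-one sequence of involutions has length `|G|` and that `|G| - 2`
divides the differences of lengths over its terms. Its partial products form a Hamiltonian cycle
of the Cayley graph. A chord of this cycle would split it into two product-one sequences of
length less than `|G|`, in which all multiplicities are even; so there are no chords,
only two involutions occur, and they alternate. -/
theorem exists_dihedral_of_isMinimal [Finite G] (hG : ¬ IsCyclic G) {d : ℕ}
    (hd : d + 2 = Nat.card G) (hd0 : 0 < d) {G₀ : Set G} (hG₀ : DvdLengthDiffs G₀ d)
    {U : Multiset G} (hU : IsMinimal U) (hUG : ∀ g ∈ U, g ∈ G₀) (hcard : U.card = d + 2)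
    (hord : ∀ g ∈ U, orderOf g = 2) :
    ∃ n : ℕ, 3 ≤ n ∧ Odd n ∧ Nonempty (G ≃* DihedralGroup n) := by
  classical
  have hsq : ∀ g ∈ U, g * g = 1 := fun g hg => by
    rw [← pow_two, ← hord g hg, pow_orderOf_eq_one]
  have hne1 : ∀ g ∈ U, g ≠ 1 := fun g hg h => by
    have := hord g hg
    rw [h, orderOf_one] at this
    omega
  obtain ⟨l, rfl, hl1⟩ := hU.isProductOne
  rw [Multiset.coe_card] at hcard
  have hnotall : ∃ g, Odd (Multiset.count g (l : Multiset G)) :=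
    hU.exists_odd_count hsq (by rw [Multiset.coe_card]; omega)
  have hshort : ∀ T : Multiset G, (∀ g ∈ T, g ∈ l) → IsProductOne T → T.card < d + 2 →
      ∀ g, Even (T.count g) := fun T hT hT1 hlt g => by
    by_contra hodd
    have := hG₀.le_card_of_odd_count hT1 (fun x hx => hUG x (hT x hx))
      (fun h => hne1 1 (hT 1 h) rfl) (fun x hx => hsq x (hT x hx)) (Nat.not_even_iff_odd.1 hodd)
    omega
  have hsurj : ∀ g : G, ∃ i : Fin l.length, (l.take i).prod = g := by
    have hinj := hU.partial_prod_injective hl1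
    have := (Nat.bijective_iff_injective_and_card _).2 ⟨hinj, by rw [Nat.card_fin, hcard, hd]⟩
    exact this.2
  -- Every term is the first or the last one.
  have hpos : 0 < l.length := by omega
  have htwo : ∀ c ∈ l, c = l[0] ∨ c = l[l.length - 1] := by
    intro c hc
    obtain ⟨⟨i, hi⟩, hic⟩ := hsurj c
    change (l.take i).prod = c at hic
    have hcc := hsq c hc
    have hdrop : (l.drop i).prod = c := by
      rw [← List.prod_take_mul_prod_drop l i, hic] at hl1
      rw [← mul_left_cancel_iff (a := c), hl1, hcc]
    have hi0 : i ≠ 0 := by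
      rintro rfl
      exact hne1 c hc (by simpa using hic.symm)
    by_cases hi1 : i = 1
    · subst hi1
      left
      rw [← hic, List.take_one, List.head?_eq_getElem?, List.getElem?_eq_getElem hpos]
      simp
    by_cases hi2 : i = l.length - 1
    · right
      have := List.drop_eq_getElem_cons (l := l) (i := i) hi
      rw [this, List.drop_eq_nil_of_le (by omega)] at hdrop
      subst hi2
      simpa using hdrop.symm
    exfalso
    have h1 := hshort ((c :: l.take i : List G) : Multiset G)
      (fun g hg => by
        rcases List.mem_cons.1 (Multiset.mem_coe.1 hg) with rfl | h
        · exact hc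
        · exact List.mem_of_mem_take h)
      (isProductOne_coe (by rw [List.prod_cons, hic, hcc]))
      (by rw [Multiset.coe_card, List.length_cons, List.length_take]; omega)
    have h2 := hshort ((c :: l.drop i : List G) : Multiset G)
      (fun g hg => by
        rcases List.mem_cons.1 (Multiset.mem_coe.1 hg) with rfl | h
        · exact hc
        · exact List.mem_of_mem_drop h)
      (isProductOne_coe (by rw [List.prod_cons, hdrop, hcc]))
      (by rw [Multiset.coe_card, List.length_cons, List.length_drop]; omega)
    obtain ⟨g, hg⟩ := hnotall
    have h1g := h1 g
    have h2g := h2 g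
    have hsplit : l.count g = (l.take i).count g + (l.drop i).count g := by
      rw [← List.count_append, List.take_append_drop]
    rw [Multiset.coe_count] at h1g h2g hg
    rw [List.count_cons, Nat.even_iff] at h1g h2g
    rw [Nat.odd_iff] at hg
    omega
  set a := l[0] with ha
  set b := l[l.length - 1] with hb
  have hal : a ∈ l := List.getElem_mem _
  have hbl : b ∈ l := List.getElem_mem _
  obtain ⟨e⟩ := exists_mulEquiv_dihedralGroup (hsq a hal) (hsq b hbl) (fun g => by
    obtain ⟨i, hi⟩ := hsurj g
    exact ⟨_, fun x hx => htwo x (List.mem_of_mem_take hx), hi⟩) hG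
  have hcardG : d + 2 = 2 * orderOf (a * b) := by
    rw [hd, Nat.card_congr e.toEquiv, DihedralGroup.nat_card]
  have hchain : l.IsChain (· ≠ ·) := by
    rw [List.isChain_iff_getElem]
    intro i hi heq
    have hx : l[i] ∈ l := List.getElem_mem _
    have hsplit : l = l.take i ++ l[i] :: l[i] :: l.drop (i + 2) := by
      conv_lhs => rw [← List.take_append_drop i l, List.drop_eq_getElem_cons (by omega),
        List.drop_eq_getElem_cons hi, ← heq]
    have hrest : IsProductOne ((l.take i ++ l.drop (i + 2) : List G) : Multiset G) := by
      refine isProductOne_coe ?_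
      have h := hl1
      rw [hsplit, List.prod_append, List.prod_cons, List.prod_cons, ← mul_assoc l[i],
        hsq _ hx, one_mul] at h
      rwa [List.prod_append]
    have := hU.eq_of_add (isProductOne_pair (hsq _ hx)) hrest (by
      conv_rhs => rw [hsplit]
      simp only [← Multiset.coe_add, ← Multiset.cons_coe, Multiset.insert_eq_cons,
        ← Multiset.singleton_add]
      abel) (by simp)
    have := congrArg Multiset.card this
    rw [Multiset.coe_card] at this
    simp at this
    omega
  have hab : a ≠ b := by
    intro h
    have h0 := (List.isChain_iff_getElem.1 hchain) 0 (by omega)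
    have h1 : l[0 + 1] = a := (htwo _ (List.getElem_mem _)).elim id fun h' => h'.trans h.symm
    exact h0 h1.symm
  have hodd : Odd (orderOf (a * b)) := by
    obtain ⟨h0, h1, h2, -, -⟩ := count_le_count_of_isChain hab l htwo hchain
    obtain ⟨g, hg⟩ := hnotall
    rw [Multiset.coe_count] at hg
    rcases htwo g (List.count_pos_iff.1 hg.pos) with h | h
    · rw [h] at hg
      rwa [show orderOf (a * b) = l.count a by omega]
    · rw [h] at hg
      rwa [show orderOf (a * b) = l.count b by omega]
  refine ⟨orderOf (a * b), ?_, hodd, ⟨e⟩⟩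
  rw [Nat.odd_iff] at hodd
  omega

end DihedralRecognition

/-! ### Sequences over dihedral groups -/

section DihedralSequences

open DihedralGroup

theorem coe_flatten_replicate {G : Type*} (g h : G) (k : ℕ) :
    (((List.replicate k [g, h]).flatten : List G) : Multiset G) = k • {g, h} := by
  induction k with
  | zero => simp
  | succ k ih =>
    rw [List.replicate_succ, List.flatten_cons, ← Multiset.coe_add, ih, succ_nsmul, add_comm]
    rfl

variable {G : Type*} [Group G]

theorem prod_flatten_replicate (g h : G) (k : ℕ) :
    (List.replicate k [g, h]).flatten.prod = (g * h) ^ k := by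
  rw [List.prod_flatten, List.map_replicate, List.prod_replicate]
  simp

theorem isProductOne_nsmul_pair {g h : G} {k : ℕ} (hk : (g * h) ^ k = 1) :
    IsProductOne (k • ({g, h} : Multiset G)) := by
  rw [← coe_flatten_replicate]
  exact isProductOne_coe (by rw [prod_flatten_replicate, hk])

theorem isProductOne_add_nsmul_pair {c g h : G} {k : ℕ} (hk : c * g * (h * g) ^ k = 1) :
    IsProductOne ({c, g} + k • ({h, g} : Multiset G)) := by
  rw [← coe_flatten_replicate]
  exact ⟨[c, g] ++ (List.replicate k [h, g]).flatten, rfl, by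
    rw [List.prod_append, prod_flatten_replicate]; simpa using hk⟩

/-- If the involution `t` inverts `g`, then `(g² t²)ᵐ = (gᵐ)² (t²)ᵐ` with `m = ord g` are
factorizations of lengths `m` and `m + 2`. -/
theorem involution_relation {g t : G} (ht : t * t = 1) (hgt : t * g * t = g⁻¹)
    (hg : 3 ≤ orderOf g) :
    orderOf g ∈ lengthSet (orderOf g • ({g, g, t, t} : Multiset G)) ∧
      orderOf g + 2 ∈ lengthSet (orderOf g • ({g, g, t, t} : Multiset G)) := by
  have hg2 : g * g ≠ 1 := fun h => by
    have := Nat.le_of_dvd two_pos (orderOf_dvd_of_pow_eq_one ((pow_two g).trans h))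
    omega
  have hg1 : g ≠ 1 := by rintro rfl; simp at hg2
  have ht1 : t ≠ 1 := by
    rintro rfl
    rw [one_mul, mul_one] at hgt
    exact hg2 (by nth_rw 1 [hgt]; simp)
  have hgt' : g ≠ t := by rintro rfl; exact hg2 ht
  have hinv : g⁻¹ ≠ g := fun h => hg2 (by nth_rw 1 [← h]; simp)
  have htinv : t⁻¹ = t := inv_eq_of_mul_eq_one_right ht
  have hone : (1 : G) ∉ ({g, g, t, t} : Multiset G) := by simp [hg1.symm, ht1.symm]
  have hmin : IsMinimal ({g, g, t, t} : Multiset G) := by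
    have hprod : IsProductOne ({g, g, t, t} : Multiset G) := by
      refine ⟨[g, t, g, t], ?_, ?_⟩
      · simp only [← Multiset.cons_coe, Multiset.coe_nil, Multiset.insert_eq_cons,
          ← Multiset.singleton_add]
        abel
      · simp only [List.prod_cons, List.prod_nil, mul_one]
        rw [← mul_assoc t, hgt, mul_inv_cancel]
    refine ⟨hprod, by simp, fun A B hA hB hAB => ?_⟩
    by_contra! hne
    have hA2 := hA.two_le_card (fun h => hone (by rw [← hAB]; simp [h])) hne.1
    have hB2 := hB.two_le_card (fun h => hone (by rw [← hAB]; simp [h])) hne.2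
    have hcard := congrArg Multiset.card hAB
    simp only [Multiset.card_add, Multiset.insert_eq_cons, Multiset.card_cons,
      Multiset.card_singleton] at hcard
    -- A part containing `g` has two terms, so its other term is `g⁻¹`, which is not available.
    have key : ∀ C ≤ ({g, g, t, t} : Multiset G), IsProductOne C → C.card = 2 → g ∉ C := by
      intro C hC hC1 hC2 hgC
      rw [hC1.eq_pair hC2 hgC] at hC
      have : g⁻¹ ∈ ({g, g, t, t} : Multiset G) := Multiset.mem_of_le hC (by simp)
      simp only [Multiset.insert_eq_cons, Multiset.mem_cons, Multiset.mem_singleton] at this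
      rcases this with h | h | h | h
      · exact hinv h
      · exact hinv h
      · exact hgt' (by rw [← inv_inv g, h, htinv])
      · exact hgt' (by rw [← inv_inv g, h, htinv])
    have : g ∈ A + B := by rw [hAB]; simp
    rcases Multiset.mem_add.1 this with h | h
    · exact key A (hAB ▸ Multiset.le_add_right A B) hA (by omega) h
    · exact key B (hAB ▸ Multiset.le_add_left B A) hB (by omega) h
  constructor
  · simpa using nsmul_mem_lengthSet hmin.one_mem_lengthSet (orderOf g)
  · have h1 := (isMinimal_replicate_orderOf (g := g) (by omega)).one_mem_lengthSet
    have h2 := nsmul_mem_lengthSet (isMinimal_pair_self ht1 ht).one_mem_lengthSet (orderOf g)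
    have := add_mem_lengthSet (add_mem_lengthSet h1 h1) h2
    rw [mul_one] at this
    convert this using 1
    · simp only [← Multiset.nsmul_singleton, Multiset.insert_eq_cons, ← Multiset.singleton_add,
        nsmul_add]
      congr 1
      abel
    · ring

theorem map_ite_sum {α : Type*} [DecidableEq α] (c : α) (S : Multiset α) (v : ℤ) :
    (S.map fun g => if g = c then v else 0).sum = S.count c * v := by
  induction S using Multiset.induction_on with
  | empty => simp
  | cons g S ih =>
    rw [Multiset.map_cons, Multiset.sum_cons, ih, Multiset.count_cons]
    by_cases h : g = c
    · simp [h]; ring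
    · simp [h, Ne.symm h]

theorem eq_add_replicate {α : Type*} [DecidableEq α] {a b : α} (hab : a ≠ b) {S : Multiset α}
    (h : ∀ g ∈ S, g = a ∨ g = b) :
    S = Multiset.replicate (S.count a) a + Multiset.replicate (S.count b) b := by
  ext g
  rw [Multiset.count_add, Multiset.count_replicate, Multiset.count_replicate]
  by_cases ha : a = g
  · subst ha; simp [hab.symm]
  by_cases hb : b = g
  · subst hb; simp [hab]
  rw [if_neg ha, if_neg hb, add_zero, Multiset.count_eq_zero]
  intro hg
  rcases h g hg with rfl | rfl
  · exact ha rfl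
  · exact hb rfl

variable {n : ℕ}

/-- In a product of rotations `r (f g • u)` and reflections `sr (x + f g • u)`, given by integers
`f g`, the resulting rotation or reflection is given by a sum of the integers `± f g`. The
function `h` is `1` on the reflections and `0` on the rotations. -/
theorem exists_signed_sum (u x : ZMod n) (f : DihedralGroup n → ℤ) (h : DihedralGroup n → ℕ)
    (l : List (DihedralGroup n)) (hl : ∀ g ∈ l, (g = r (f g • u) ∧ h g = 0) ∨
      (g = sr (x + f g • u) ∧ h g = 1)) :
    ∃ e : ℤ, 2 ∣ e - (l.map f).sum ∧ |e| ≤ (l.map fun g => |f g|).sum ∧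
      (Even (l.map h).sum ∧ l.prod = r (e • u) ∨ Odd (l.map h).sum ∧ l.prod = sr (x + e • u)) := by
  induction l with
  | nil => exact ⟨0, by simp, by simp, Or.inl (by simp)⟩
  | cons g l ih =>
    obtain ⟨e, h1, h2, h3⟩ := ih fun y hy => hl y (by simp [hy])
    simp only [List.map_cons, List.sum_cons, List.prod_cons]
    have habs : |f g + e| ≤ |f g| + (l.map fun g => |f g|).sum :=
      (abs_add_le _ _).trans (by omega)
    have habs' : |e - f g| ≤ |f g| + (l.map fun g => |f g|).sum :=
      (abs_sub _ _).trans (by omega)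
    rcases hl g (by simp) with ⟨hg, hh⟩ | ⟨hg, hh⟩
    · rcases h3 with ⟨hev, hp⟩ | ⟨hod, hp⟩
      · refine ⟨f g + e, by omega, habs, Or.inl ⟨by rwa [hh, zero_add], ?_⟩⟩
        rw [hp]
        nth_rw 1 [hg]
        rw [r_mul_r, add_smul]
      · refine ⟨e - f g, by omega, habs', Or.inr ⟨by rwa [hh, zero_add], ?_⟩⟩
        rw [hp]
        nth_rw 1 [hg]
        rw [r_mul_sr, sub_smul, add_sub_assoc]
    · rcases h3 with ⟨hev, hp⟩ | ⟨hod, hp⟩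
      · refine ⟨f g + e, by omega, habs, Or.inr ⟨by rw [hh]; exact odd_one.add_even hev, ?_⟩⟩
        rw [hp]
        nth_rw 1 [hg]
        rw [sr_mul_r, add_smul, add_assoc]
      · refine ⟨e - f g, by omega, habs', Or.inl ⟨by rw [hh]; exact odd_one.add_odd hod, ?_⟩⟩
        rw [hp]
        nth_rw 1 [hg]
        rw [sr_mul_sr, sub_smul, add_sub_add_left_eq_sub]

/-- If `u` has order `n` in `ZMod n` and exactly one letter `c` of a product-one sequence `S` has
a nonzero exponent, namely `u`, then `c` has even multiplicity or multiplicity at least `n`.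
Also the number of reflections, the letters with `h = 1`, is even. -/
theorem IsProductOne.even_or_le_count {u : ZMod n} (hu : addOrderOf u = n)
    (x : ZMod n) (c : DihedralGroup n) (h : DihedralGroup n → ℕ) {S : Multiset (DihedralGroup n)}
    (hS : IsProductOne S) (hl : ∀ g ∈ S, (g = r ((if g = c then 1 else 0 : ℤ) • u) ∧ h g = 0) ∨
      (g = sr (x + (if g = c then 1 else 0 : ℤ) • u) ∧ h g = 1)) :
    Even (S.map h).sum ∧ (Even (S.count c) ∨ n ≤ S.count c) := by
  obtain ⟨l, rfl, hl1⟩ := hS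
  obtain ⟨e, h1, h2, h3⟩ := exists_signed_sum u x _ h l fun g hg => hl g (Multiset.mem_coe.2 hg)
  rw [hl1, one_def] at h3
  rcases h3 with ⟨hev, he⟩ | ⟨-, he⟩
  · refine ⟨hev, ?_⟩
    have hsum := map_ite_sum c (l : Multiset (DihedralGroup n)) 1
    rw [Multiset.map_coe, Multiset.sum_coe, mul_one] at hsum
    have habs : (fun g : DihedralGroup n => |(if g = c then 1 else 0 : ℤ)|)
        = fun g => if g = c then 1 else 0 := by
      funext g
      split_ifs <;> simp
    rw [hsum] at h1
    rw [habs, hsum] at h2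
    have hdvd : (n : ℤ) ∣ e := by
      rw [← hu, addOrderOf_dvd_iff_zsmul_eq_zero]
      exact (r.inj he).symm
    by_contra! hcon
    rw [Nat.not_even_iff] at hcon
    have := Int.le_of_dvd (abs_pos.2 (by omega)) ((dvd_abs _ _).2 hdvd)
    omega
  · exact nomatch he

section Reflections

variable {x y : ZMod n}

theorem sr_ne_one (z : ZMod n) : (sr z : DihedralGroup n) ≠ 1 := fun h => by
  rw [one_def] at h
  exact nomatch h

theorem ne_of_addOrderOf (hn : 2 ≤ n) (hu : addOrderOf (y - x) = n) : x ≠ y := by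
  rintro rfl
  rw [sub_self, addOrderOf_zero] at hu
  omega

theorem addOrderOf_sub_comm : addOrderOf (x - y) = addOrderOf (y - x) := by
  rw [← neg_sub, addOrderOf_neg]

theorem IsProductOne.count_reflections (hn : 2 ≤ n) (hu : addOrderOf (y - x) = n)
    {S : Multiset (DihedralGroup n)} (hS : IsProductOne S) (hl : ∀ g ∈ S, g = sr x ∨ g = sr y) :
    Even S.card ∧ (Even (S.count (sr y)) ∨ n ≤ S.count (sr y)) := by
  have hxy := ne_of_addOrderOf hn hu
  have := hS.even_or_le_count hu x (sr y) (fun _ => 1) fun g hg => Or.inr (by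
    rcases hl g hg with rfl | rfl
    · simp [hxy]
    · simp)
  simpa using this

theorem sr_mul_sr_pow_eq_one (hu : addOrderOf (y - x) = n) :
    (sr x * sr y : DihedralGroup n) ^ n = 1 := by
  have := addOrderOf_nsmul_eq_zero (y - x)
  rw [hu] at this
  rw [sr_mul_sr, r_pow, one_def, mul_comm, ← nsmul_eq_mul, this]

theorem count_nsmul_pair (hxy : x ≠ y) (k : ℕ) :
    (k • ({sr x, sr y} : Multiset (DihedralGroup n))).count (sr x) = k := by
  rw [Multiset.count_nsmul, Multiset.insert_eq_cons, Multiset.count_cons_self,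
    Multiset.count_singleton]
  simp [hxy]

theorem isMinimal_nsmul_reflections (hn : 2 ≤ n) (hodd : Odd n) (hu : addOrderOf (y - x) = n) :
    IsMinimal (n • ({sr x, sr y} : Multiset (DihedralGroup n))) := by
  have hxy := ne_of_addOrderOf hn hu
  have key : ∀ A B : Multiset (DihedralGroup n), IsProductOne A →
      A + B = n • ({sr x, sr y} : Multiset (DihedralGroup n)) → Odd (A.count (sr x)) → B = 0 := by
    intro A B hA hAB hAodd
    have hmem : ∀ g ∈ A, g = sr x ∨ g = sr y := fun g hg => by
      have := Multiset.mem_of_mem_nsmul (hAB ▸ Multiset.mem_add.2 (Or.inl hg))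
      simpa using this
    obtain ⟨hev, hy⟩ := hA.count_reflections hn hu hmem
    obtain ⟨-, hx⟩ := hA.count_reflections hn (addOrderOf_sub_comm.trans hu)
      fun g hg => (hmem g hg).symm
    have hcard := congrArg Multiset.card
      (eq_add_replicate (a := sr x) (b := sr y) (by simpa using hxy) hmem)
    have hcardAB := congrArg Multiset.card hAB
    simp only [Multiset.card_add, Multiset.card_replicate, Multiset.card_nsmul,
      Multiset.insert_eq_cons, Multiset.card_cons, Multiset.card_singleton] at hcard hcardAB
    rw [Nat.odd_iff] at hAodd
    rw [Nat.even_iff] at hev hx hy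
    exact Multiset.card_eq_zero.1 (by omega)
  refine ⟨isProductOne_nsmul_pair (sr_mul_sr_pow_eq_one hu), fun h0 => ?_,
    fun A B hA hB hAB => ?_⟩
  · have := congrArg Multiset.card h0
    rw [Multiset.card_nsmul] at this
    simp at this
    omega
  · have hcount := congrArg (Multiset.count (sr x)) hAB
    rw [Multiset.count_add, count_nsmul_pair hxy] at hcount
    rcases Nat.even_or_odd (A.count (sr x)) with h | h
    · refine Or.inl (key B A hB (by rw [add_comm, hAB]) ?_)
      rw [Nat.odd_iff] at *
      rw [Nat.even_iff] at h
      omega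
    · exact Or.inr (key A B hA hAB h)

/-- The minimal product-one sequences over `1` and two reflections `a`, `b` with `ord (a b) = n`
are `1`, `a²`, `b²` and `aⁿ bⁿ`. -/
theorem IsMinimal.eq_of_over_reflections (hn : 2 ≤ n) (hodd : Odd n) (hu : addOrderOf (y - x) = n)
    {A : Multiset (DihedralGroup n)} (hA : IsMinimal A)
    (hl : ∀ g ∈ A, g ∈ ({1, sr x, sr y} : Set (DihedralGroup n))) :
    A = {1} ∨ A = {sr x, sr x} ∨ A = {sr y, sr y} ∨ A = n • {sr x, sr y} := by
  have hxy := ne_of_addOrderOf hn hu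
  by_cases h1 : 1 ∈ A
  · exact Or.inl (hA.eq_singleton_one h1)
  have hmem : ∀ g ∈ A, g = sr x ∨ g = sr y := fun g hg => by
    rcases hl g hg with rfl | h
    · exact absurd hg h1
    · simpa using h
  obtain ⟨hev, hy⟩ := hA.isProductOne.count_reflections hn hu hmem
  obtain ⟨-, hx⟩ := hA.isProductOne.count_reflections hn (addOrderOf_sub_comm.trans hu)
    fun g hg => (hmem g hg).symm
  have hrep := eq_add_replicate (a := sr x) (b := sr y) (by simpa using hxy) hmem
  have hcard := congrArg Multiset.card hrep
  simp only [Multiset.card_add, Multiset.card_replicate] at hcard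
  rw [Nat.even_iff] at hev hx hy
  have hpos := hA.card_pos
  set i := A.count (sr x) with hi
  set j := A.count (sr y) with hj
  have hrepl : ∀ (z : ZMod n) (k : ℕ), k % 2 = 0 →
      IsProductOne (Multiset.replicate k (sr z : DihedralGroup n)) := fun z k hk => by
    rw [isProductOne_replicate, ← Nat.mul_div_cancel' (Nat.dvd_of_mod_eq_zero hk), pow_mul,
      pow_two, sr_mul_self, one_pow]
  by_cases hi0 : i % 2 = 0
  · by_cases hi2 : 2 ≤ i
    · refine Or.inr (Or.inl (hA.eq_of_add (hrepl x 2 rfl)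
        ((hrepl x (i - 2) (by omega)).add (hrepl y j (by omega))) ?_ (by simp)))
      rw [← add_assoc, show ({sr x, sr x} : Multiset (DihedralGroup n)) =
        Multiset.replicate 2 (sr x) from rfl, ← Multiset.replicate_add, Nat.add_sub_cancel' hi2,
        ← hrep]
    · refine Or.inr (Or.inr (Or.inl (hA.eq_of_add (hrepl y 2 rfl)
        ((hrepl y (j - 2) (by omega)).add (hrepl x i (by omega))) ?_ (by simp))))
      rw [← add_assoc, show ({sr y, sr y} : Multiset (DihedralGroup n)) =
        Multiset.replicate 2 (sr y) from rfl, ← Multiset.replicate_add,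
        Nat.add_sub_cancel' (by omega), add_comm, ← hrep]
  · refine Or.inr (Or.inr (Or.inr (hA.eq_of_add
      (isProductOne_nsmul_pair (sr_mul_sr_pow_eq_one hu))
      (B := Multiset.replicate (i - n) (sr x) + Multiset.replicate (j - n) (sr y)) ?_ ?_ ?_)))
    · rw [Nat.odd_iff] at hodd
      exact (hrepl x (i - n) (by omega)).add (hrepl y (j - n) (by omega))
    · rw [nsmul_pair, add_add_add_comm, ← Multiset.replicate_add, ← Multiset.replicate_add,
        Nat.add_sub_cancel' (by omega), Nat.add_sub_cancel' (by omega), ← hrep]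
    · intro h0
      have := congrArg Multiset.card h0
      rw [Multiset.card_nsmul] at this
      simp at this
      omega

/-- The lengths over `1` and two reflections `a`, `b` with `ord (a b) = n` are determined modulo
`2 * n - 2`. -/
theorem dvdLengthDiffs_reflections (hn : 2 ≤ n) (hodd : Odd n) (hu : addOrderOf (y - x) = n) :
    DvdLengthDiffs ({1, sr x, sr y} : Set (DihedralGroup n)) (2 * n - 2) := by
  have hxy := ne_of_addOrderOf hn hu
  obtain ⟨m, rfl⟩ := hodd
  -- Modulo `4 * (n - 1)` all four atoms have weight `2`; for `aⁿ bⁿ` this uses that `n - 1` is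
  -- even.
  refine dvdLengthDiffs_of_weight
    (fun g => if g = 1 then 2 else if g = sr x then 3 - 2 * ((2 * m + 1 : ℕ) : ℤ) else 1) 2
    two_ne_zero fun A hA hAG => ?_
  have hx1 : (sr x : DihedralGroup (2 * m + 1)) ≠ 1 := sr_ne_one x
  have hy1 : (sr y : DihedralGroup (2 * m + 1)) ≠ 1 := sr_ne_one y
  have he : ((2 * (2 * m + 1) - 2 : ℕ) : ℤ) = 4 * m := by omega
  rw [he]
  rcases hA.eq_of_over_reflections hn ⟨m, rfl⟩ hu hAG with rfl | rfl | rfl | rfl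
  · simp
  · simp [hx1]
    exact ⟨-1, by ring⟩
  · simp [hy1, hxy.symm]
  · rw [Multiset.map_nsmul, Multiset.sum_nsmul]
    simp [hx1, hy1, hxy.symm]
    exact ⟨-m, by ring⟩

theorem two_mul_sub_two_mem_deltaStar (hn : 3 ≤ n) (hodd : Odd n) :
    2 * n - 2 ∈ deltaStar (DihedralGroup n) := by
  have hu : addOrderOf ((1 : ZMod n) - 0) = n := by rw [sub_zero, ZMod.addOrderOf_one]
  have hxy := ne_of_addOrderOf (by omega) hu
  have hmin := (isMinimal_nsmul_reflections (by omega) hodd hu).one_mem_lengthSet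
  have hsq : ∀ z : ZMod n, n ∈ lengthSet (n • ({sr z, sr z} : Multiset (DihedralGroup n))) :=
    fun z => by
      have := isMinimal_pair_self (sr_ne_one z) (sr_mul_self z)
      simpa using nsmul_mem_lengthSet this.one_mem_lengthSet n
  refine mem_deltaStar_iff.2 ⟨by omega, _, dvdLengthDiffs_reflections (by omega) hodd hu,
    n • ({sr 0, sr 1} : Multiset _) + n • {sr 0, sr 1}, fun g hg => ?_, 2,
    add_mem_lengthSet hmin hmin, ?_⟩
  · rw [← two_nsmul] at hg
    have := Multiset.mem_of_mem_nsmul (Multiset.mem_of_mem_nsmul hg)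
    simp at this
    exact Or.inr (by simpa using this)
  · have := add_mem_lengthSet (hsq 0) (hsq 1)
    rw [← nsmul_add] at this ⊢
    convert this using 1
    · simp only [Multiset.insert_eq_cons, ← Multiset.singleton_add]
      congr 2
      abel
    · omega

end Reflections

end DihedralSequences

/-! ### Minimal distances of dihedral groups -/

section DihedralDistances

open DihedralGroup

variable {n : ℕ}

theorem isProductOne_rotation_reflection {g t : DihedralGroup n} (ht : t * t = 1)
    (hgt : t * g * t = g⁻¹) {i j : ℕ} (hi : Even i) (hj : Even j) (hj2 : 2 ≤ j) :
    IsProductOne (Multiset.replicate i g + Multiset.replicate j t) := by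
  obtain ⟨k, rfl⟩ := hi
  obtain ⟨m, rfl⟩ := hj
  obtain ⟨m, rfl⟩ : ∃ p, m = p + 1 := ⟨m - 1, by omega⟩
  have htinv : t⁻¹ = t := inv_eq_of_mul_eq_one_right ht
  refine ⟨List.replicate k g ++ [t] ++ List.replicate k g ++ [t] ++ List.replicate (m + m) t,
    ?_, ?_⟩
  · simp only [← Multiset.coe_add, Multiset.coe_replicate, Multiset.coe_singleton,
      ← Multiset.nsmul_singleton]
    rw [show m + 1 + (m + 1) = m + m + 1 + 1 by ring]
    simp only [add_nsmul, one_nsmul]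
    abel
  · have h1 : t * g ^ k * t = (g ^ k)⁻¹ := by
      have := conj_pow (a := t) (b := g) (i := k)
      rw [htinv, hgt, inv_pow] at this
      exact this.symm
    simp only [List.prod_append, List.prod_replicate, List.prod_singleton]
    rw [mul_assoc (g ^ k), mul_assoc (g ^ k), h1, mul_inv_cancel, one_mul, ← two_mul, pow_mul,
      pow_two, ht, one_pow]

/-- Over a rotation `r 1` and a reflection `sr 0` the numbers of factors of two factorizations have
the same parity. -/
theorem dvdLengthDiffs_rotation_reflection (hn : 2 ≤ n) (hodd : Odd n) :
    DvdLengthDiffs ({r 1, sr 0} : Set (DihedralGroup n)) 2 := by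
  have hne : (r 1 : DihedralGroup n) ≠ sr 0 := nofun
  have hne' : (sr 0 : DihedralGroup n) ≠ r 1 := nofun
  -- The atoms are `gⁿ`, `t²` and sequences `g²ᵏ t²`; the weight `2` for `g` and `1` for `t` is
  -- `2` modulo `4` on each of them.
  refine dvdLengthDiffs_of_weight (fun g => if g = r 1 then 2 else 1) 2 two_ne_zero
    fun A hA hAG => ?_
  have hmem : ∀ g ∈ A, g = r 1 ∨ g = sr 0 := fun g hg => by simpa using hAG g hg
  have hone : addOrderOf (1 : ZMod n) = n := ZMod.addOrderOf_one n
  have hrep := eq_add_replicate hne hmem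
  have hrot : ∀ k, n ∣ k → IsProductOne (Multiset.replicate k (r 1 : DihedralGroup n)) :=
    fun k hk => by
      rw [isProductOne_replicate, ← orderOf_dvd_iff_pow_eq_one, orderOf_r_one]
      exact hk
  have hmix : ∀ i j, Even i → Even j → 2 ≤ j →
      IsProductOne (Multiset.replicate i (r 1 : DihedralGroup n) + Multiset.replicate j (sr 0)) :=
    fun i j => isProductOne_rotation_reflection (sr_mul_self 0) (by simp)
  set i := A.count (r 1) with hi
  set j := A.count (sr 0) with hj
  have hsum : (A.map fun g => if g = r 1 then (2 : ℤ) else 1).sum = 2 * i + j := by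
    rw [hrep]
    simp [hne']
    ring
  have hcount : Even j ∧ (Even i ∨ n ≤ i) := by
    have := hA.isProductOne.even_or_le_count hone 0 (r 1) (fun g => if g = sr 0 then 1 else 0)
      fun g hg => by
        rcases hmem g hg with rfl | rfl
        · simp
        · simp
    refine ⟨?_, this.2⟩
    have h1 := this.1
    rw [hrep] at h1
    simpa using h1
  rw [hsum]
  obtain ⟨hjev, hin⟩ := hcount
  -- Whenever `n` terms `g` can be split off, nothing else is left.
  have hsplit : n ≤ i → IsProductOne (Multiset.replicate (i - n) (r 1 : DihedralGroup n) +
      Multiset.replicate j (sr 0)) → i = n ∧ j = 0 := by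
    intro hni hrest
    have := hA.eq_of_add (hrot n dvd_rfl) hrest (by
      rw [← add_assoc, ← Multiset.replicate_add, Nat.add_sub_cancel' hni, ← hrep]) (fun h0 => by
        have := congrArg Multiset.card h0
        rw [Multiset.card_replicate, Multiset.card_zero] at this
        omega)
    rw [hi, hj, this]
    simp [Multiset.count_replicate, hne]
  rw [Nat.odd_iff] at hodd
  by_cases hj0 : j = 0
  · have h1 := hA.isProductOne
    rw [hrep, hj0, Multiset.replicate_zero, add_zero, isProductOne_replicate,
      ← orderOf_dvd_iff_pow_eq_one, orderOf_r_one] at h1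
    have hpos : 0 < i := by
      have := hA.card_pos
      rw [hrep, Multiset.card_add, Multiset.card_replicate, Multiset.card_replicate] at this
      omega
    have hni := Nat.le_of_dvd hpos h1
    obtain ⟨h2, -⟩ := hsplit hni (by
      rw [hj0, Multiset.replicate_zero, add_zero]
      exact hrot _ (Nat.dvd_sub h1 dvd_rfl))
    omega
  · have hj2 : 2 ≤ j := by rw [Nat.even_iff] at hjev; omega
    have hiev : Even i := by
      by_contra hiodd
      have hni := hin.resolve_left hiodd
      rw [Nat.not_even_iff] at hiodd
      obtain ⟨-, h⟩ := hsplit hni (hmix _ _ (by rw [Nat.even_iff]; omega) hjev hj2)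
      exact hj0 h
    rw [Nat.even_iff] at hiev hjev
    by_cases hj4 : 4 ≤ j
    · have := hA.eq_of_add (hmix 0 2 Even.zero even_two le_rfl)
        (hmix i (j - 2) (Nat.even_iff.2 hiev) (by rw [Nat.even_iff]; omega) (by omega)) (by
          rw [Multiset.replicate_zero, zero_add, add_left_comm, ← Multiset.replicate_add,
            Nat.add_sub_cancel' hj2, ← hrep]) (by simp)
      have := congrArg Multiset.card this
      rw [hrep] at this
      simp at this
      omega
    · omega

theorem two_mem_deltaStar (hn : 3 ≤ n) (hodd : Odd n) : 2 ∈ deltaStar (DihedralGroup n) := by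
  obtain ⟨h1, h2⟩ := involution_relation (g := (r 1 : DihedralGroup n)) (t := sr 0)
    (sr_mul_self 0) (by simp) (by rwa [orderOf_r_one])
  refine mem_deltaStar_iff.2 ⟨two_pos, _, dvdLengthDiffs_rotation_reflection (by omega) hodd,
    _, fun g hg => ?_, _, h1, h2⟩
  have := Multiset.mem_of_mem_nsmul hg
  simpa using this

/-- If `d ≥ n - 1`, then the exponent of a third reflection over `G₀` is the midpoint of those of
the first two. In the Cayley graph of the first two reflections, a cycle of length `2 * n`, every
edge of the third one is a chord; it closes two product-one sequences, both of which have
at least `d + 2` terms. -/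
theorem midpoint_of_reflections {d : ℕ} {G₀ : Set (DihedralGroup n)} (hG : DvdLengthDiffs G₀ d)
    (hd : n ≤ d + 1) {x y z : ZMod n} (hn : 2 ≤ n) (hu : addOrderOf (y - x) = n) (hx : sr x ∈ G₀)
    (hy : sr y ∈ G₀) (hz : sr z ∈ G₀) (hzx : z ≠ x) (hzy : z ≠ y) :
    2 * z = x + y ∧ d + 1 ≤ n := by
  have : NeZero n := ⟨by omega⟩
  obtain ⟨j, hjn, hj⟩ : ∃ j < n, j • (y - x) = z - x := by
    have htop : AddSubgroup.zmultiples (y - x) = ⊤ :=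
      AddSubgroup.eq_top_of_card_eq _ (by rw [Nat.card_zmultiples, hu, Nat.card_zmod])
    have hmem : z - x ∈ AddSubgroup.zmultiples (y - x) := htop ▸ AddSubgroup.mem_top _
    rw [mem_zmultiples_iff_mem_range_addOrderOf, hu] at hmem
    simpa using hmem
  have hj0 : j ≠ 0 := by
    rintro rfl
    rw [zero_nsmul] at hj
    exact hzx (sub_eq_zero.1 hj.symm)
  have hj1 : j ≠ 1 := by
    rintro rfl
    rw [one_nsmul] at hj
    exact hzy (sub_left_inj.1 hj).symm
  rw [nsmul_eq_mul] at hj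
  have hxG : ∀ {T : Multiset (DihedralGroup n)}, (∀ g ∈ T, g = sr x ∨ g = sr y ∨ g = sr z) →
      IsProductOne T → T.count (sr z) = 1 → d + 2 ≤ T.card := fun hT hT1 hc =>
    hG.le_card_of_odd_count hT1
      (fun g hg => by rcases hT g hg with rfl | rfl | rfl <;> assumption)
      (fun h => by
        rcases hT 1 h with h | h | h
        · exact sr_ne_one _ h.symm
        · exact sr_ne_one _ h.symm
        · exact sr_ne_one _ h.symm)
      (fun g hg => by rcases hT g hg with rfl | rfl | rfl <;> exact sr_mul_self _)
      (g := sr z) (by rw [hc]; exact odd_one)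
  have h1 := hxG (T := {sr z, sr y} + (j - 1) • {sr x, sr y})
    (fun g hg => by
      rcases Multiset.mem_add.1 hg with h | h
      · simp only [Multiset.insert_eq_cons, Multiset.mem_cons, Multiset.mem_singleton] at h
        tauto
      · have h := Multiset.mem_of_mem_nsmul h
        simp only [Multiset.insert_eq_cons, Multiset.mem_cons, Multiset.mem_singleton] at h
        tauto)
    (isProductOne_add_nsmul_pair (by
      rw [sr_mul_sr, sr_mul_sr, r_pow, r_mul_r, one_def, Nat.cast_sub (by omega)]
      congr 1
      linear_combination hj))
    (by simp [hzx, hzy])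
  have h2 := hxG (T := {sr z, sr x} + (n - j) • {sr y, sr x})
    (fun g hg => by
      rcases Multiset.mem_add.1 hg with h | h
      · simp only [Multiset.insert_eq_cons, Multiset.mem_cons, Multiset.mem_singleton] at h
        tauto
      · have h := Multiset.mem_of_mem_nsmul h
        simp only [Multiset.insert_eq_cons, Multiset.mem_cons, Multiset.mem_singleton] at h
        tauto)
    (isProductOne_add_nsmul_pair (by
      rw [sr_mul_sr, sr_mul_sr, r_pow, r_mul_r, one_def, Nat.cast_sub hjn.le, ZMod.natCast_self]
      congr 1
      linear_combination hj))
    (by simp [hzx, hzy])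
  simp only [Multiset.card_add, Multiset.card_nsmul, Multiset.insert_eq_cons, Multiset.card_cons,
    Multiset.card_singleton] at h1 h2
  refine ⟨?_, by omega⟩
  have h2j : ((2 * j : ℕ) : ZMod n) = 1 := by
    rw [show 2 * j = n + 1 by omega, Nat.cast_add, ZMod.natCast_self, zero_add, Nat.cast_one]
  push_cast at h2j
  linear_combination (y - x) * h2j - 2 * hj

theorem le_of_mem_deltaStar_dihedralGroup (hn : 3 ≤ n) (hodd : Odd n) {d : ℕ}
    (hd : d ∈ deltaStar (DihedralGroup n)) (hne : d ≠ 2 * n - 2) : d ≤ max 2 (n - 2) := by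
  have : NeZero n := ⟨by omega⟩
  by_contra! hlt
  rw [max_lt_iff] at hlt
  have hd2n : d + 2 ≤ 2 * n := by
    have := (le_davenport_of_mem_deltaStar hd).trans davenport_le_card
    rwa [DihedralGroup.nat_card] at this
  obtain ⟨hd0, G₀, hG, A, hA, k, hk, hkd⟩ := mem_deltaStar_iff.1 hd
  by_cases hrefl : ∃ x, sr x ∈ G₀
  swap
  · obtain ⟨U, hU, hUG, hcard, -⟩ := exists_long_isMinimal hd0 hG hA hk hkd
    have := hU.card_le_subgroup (Subgroup.zpowers (r 1)) fun g hg => by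
      rcases g with i | i
      · exact ⟨(i.val : ℤ), by simp⟩
      · exact absurd ⟨i, hUG _ hg⟩ hrefl
    rw [Nat.card_zpowers, orderOf_r_one] at this
    omega
  obtain ⟨x, hx⟩ := hrefl
  by_cases hrot : ∃ i, i ≠ 0 ∧ r i ∈ G₀
  · obtain ⟨i, hi, hiG⟩ := hrot
    have hdvd : orderOf (r i) ∣ n := orderOf_dvd_of_pow_eq_one (by
      rw [r_pow, ZMod.natCast_self, mul_zero, one_def])
    have h1 : orderOf (r i) ≠ 1 := fun h => hi (by
      rw [orderOf_eq_one_iff, one_def] at h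
      exact r.inj h)
    have h2 : orderOf (r i) % 2 = 1 := Nat.odd_iff.1 (hodd.of_dvd_nat hdvd)
    obtain ⟨h3, h4⟩ := involution_relation (g := (r i : DihedralGroup n)) (t := sr x)
      (sr_mul_self x) (by simp) (by omega)
    have := hG.le_of_lt (fun g hg => by
      have := Multiset.mem_of_mem_nsmul hg
      simp only [Multiset.insert_eq_cons, Multiset.mem_cons, Multiset.mem_singleton] at this
      rcases this with rfl | rfl | rfl | rfl <;> assumption) h3 h4 (by omega)
    omega
  push Not at hrot
  have hlet : ∀ g ∈ G₀, g = 1 ∨ ∃ z, g = sr z := fun g hg => by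
    rcases g with i | i
    · by_cases hi : i = 0
      · exact Or.inl (by rw [hi, one_def])
      · exact absurd hg (hrot i hi)
    · exact Or.inr ⟨i, rfl⟩
  -- Otherwise `aᵐ bᵐ` with `m = ord (a b) ≤ n / 2` is too short for its odd multiplicities.
  have horder : ∀ x y : ZMod n, sr x ∈ G₀ → sr y ∈ G₀ → x ≠ y → addOrderOf (y - x) = n := by
    intro x y hx hy hxy
    have hdvd : addOrderOf (y - x) ∣ n := addOrderOf_dvd_of_nsmul_eq_zero (by simp)
    have hmodd := hodd.of_dvd_nat hdvd
    have hmem : ∀ g ∈ addOrderOf (y - x) • ({sr x, sr y} : Multiset (DihedralGroup n)),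
        g = sr x ∨ g = sr y := fun g hg => by
      simpa using Multiset.mem_of_mem_nsmul hg
    have := hG.le_card_of_odd_count
      (isProductOne_nsmul_pair (g := sr x) (h := sr y) (k := addOrderOf (y - x)) (by
        rw [sr_mul_sr, r_pow, one_def, mul_comm, ← nsmul_eq_mul, addOrderOf_nsmul_eq_zero]))
      (fun g hg => by rcases hmem g hg with rfl | rfl <;> assumption)
      (fun h => by rcases hmem 1 h with h | h <;> exact sr_ne_one _ h.symm)
      (fun g hg => by rcases hmem g hg with rfl | rfl <;> exact sr_mul_self _)
      (g := sr x) (by rwa [count_nsmul_pair hxy])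
    simp only [Multiset.card_nsmul, Multiset.insert_eq_cons, Multiset.card_cons,
      Multiset.card_singleton] at this
    obtain ⟨q, hq⟩ := hdvd
    by_contra hmn
    have hq2 : 2 ≤ q := by
      by_contra! h
      interval_cases q
      · omega
      · omega
    have := Nat.mul_le_mul_left (addOrderOf (y - x)) hq2
    omega
  have hfinal : ∀ y : ZMod n, addOrderOf (y - x) = n → ¬ G₀ ⊆ {1, sr x, sr y} := by
    intro y hu hsub
    have := ((dvdLengthDiffs_reflections (by omega) hodd hu).mono hsub).le_of_lt hA hk hkd
      (by omega)
    omega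
  by_cases hy : ∃ y, sr y ∈ G₀ ∧ x ≠ y
  swap
  · refine hfinal (x + 1) (by rw [add_sub_cancel_left, ZMod.addOrderOf_one]) fun g hg => ?_
    rcases hlet g hg with rfl | ⟨z, rfl⟩
    · simp
    · by_cases hz : x = z
      · simp [hz]
      · exact absurd ⟨z, hg, hz⟩ hy
  obtain ⟨y, hy, hxy⟩ := hy
  have hu := horder x y hx hy hxy
  by_cases hz : ∃ z, sr z ∈ G₀ ∧ z ≠ x ∧ z ≠ y
  swap
  · refine hfinal y hu fun g hg => ?_
    rcases hlet g hg with rfl | ⟨z, rfl⟩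
    · simp
    · by_cases hzx : z = x
      · simp [hzx]
      by_cases hzy : z = y
      · simp [hzy]
      exact absurd ⟨z, hg, hzx, hzy⟩ hz
  -- Each of three exponents is the midpoint of the other two, so `3 * (y - x) = 0`.
  obtain ⟨z, hz, hzx, hzy⟩ := hz
  obtain ⟨-, hdn⟩ := midpoint_of_reflections hG (by omega) (by omega) hu hx hy hz hzx hzy
  obtain ⟨h1, -⟩ := midpoint_of_reflections hG (by omega) (by omega)
    (horder x z hx hz hzx.symm) hx hz hy hxy.symm hzy.symm
  obtain ⟨h2, -⟩ := midpoint_of_reflections hG (by omega) (by omega)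
    (horder y z hy hz hzy.symm) hy hz hx hxy hzx.symm
  have h3 : 3 • (y - x) = 0 := by
    rw [nsmul_eq_mul]
    push_cast
    linear_combination h1 - h2
  have := Nat.le_of_dvd three_pos (addOrderOf_dvd_of_nsmul_eq_zero h3)
  omega

theorem isGreatest_deltaStar_diff (hn : 3 ≤ n) (hodd : Odd n) :
    {1, 2, n - 2, 2 * n - 2} ⊆ deltaStar (DihedralGroup n) ∧
      IsGreatest (deltaStar (DihedralGroup n) \ {2 * n - 2}) (max 2 (n - 2)) := by
  have : NeZero n := ⟨by omega⟩
  have h2 := two_mem_deltaStar hn hodd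
  have hn2 : n - 2 ∈ deltaStar (DihedralGroup n) := by
    have := orderOf_sub_two_mem_deltaStar (g := (r 1 : DihedralGroup n)) (by rwa [orderOf_r_one])
    rwa [orderOf_r_one] at this
  refine ⟨?_, ⟨?_, ?_⟩, fun d hd => le_of_mem_deltaStar_dihedralGroup hn hodd hd.1 hd.2⟩
  · rintro d (rfl | rfl | rfl | rfl)
    · exact one_mem_deltaStar (by rw [DihedralGroup.nat_card]; omega)
    · exact h2
    · exact hn2
    · exact two_mul_sub_two_mem_deltaStar hn hodd
  · rcases max_choice 2 (n - 2) with h | h <;> rw [h] <;> assumption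
  · rw [Set.mem_singleton_iff]
    omega

end DihedralDistances

theorem isGreatest_deltaStar_card_sub_two_iff {G : Type*} [Group G] [Finite G]
    (hG : 3 ≤ Nat.card G) :
    IsGreatest (deltaStar G) (Nat.card G - 2) ↔
      IsCyclic G ∨ ∃ n : ℕ, 3 ≤ n ∧ Odd n ∧ Nonempty (G ≃* DihedralGroup n) := by
  constructor
  · intro h
    by_cases hc : IsCyclic G
    · exact Or.inl hc
    have h1 := le_davenport_of_mem_deltaStar h.1
    have h2 := davenport_le_card (G := G)
    obtain ⟨G₀, U, hG₀, hU, hUG, hcard, hord⟩ := exists_isMinimal_involutions hc (by omega) h.1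
    exact Or.inr (exists_dihedral_of_isMinimal hc (by omega) (by omega) hG₀ hU hUG hcard hord)
  · intro h
    refine ⟨?_, fun d hd => ?_⟩
    · rcases h with h | ⟨n, hn, hodd, ⟨e⟩⟩
      · obtain ⟨g, hg⟩ := IsCyclic.exists_ofOrder_eq_natCard (α := G)
        rw [← hg]
        exact orderOf_sub_two_mem_deltaStar (by omega)
      · rw [deltaStar_congr e, Nat.card_congr e.toEquiv, DihedralGroup.nat_card]
        exact two_mul_sub_two_mem_deltaStar hn hodd
    · have h1 := le_davenport_of_mem_deltaStar hd
      have h2 := davenport_le_card (G := G)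
      omega

theorem exists_isGreatest_deltaStar {G : Type*} [Group G] [Finite G] (hG : 3 ≤ Nat.card G) :
    ∃ m : ℕ, IsGreatest (deltaStar G) m ∧ m + 2 ≤ davenport G := by
  have hb : BddAbove (deltaStar G) := ⟨davenport G, fun d hd => by
    have := le_davenport_of_mem_deltaStar hd
    omega⟩
  have hmem := Nat.sSup_mem ⟨1, one_mem_deltaStar hG⟩ hb
  exact ⟨_, ⟨hmem, fun d hd => le_csSup hb hd⟩, le_davenport_of_mem_deltaStar hmem⟩

end ProductOne

theorem theorem6p6 (G : Type*) [Group G] [Finite G] (hG : 3 ≤ Nat.card G) :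
    (1 ∈ ProductOne.deltaStar G ∧
      ∀ g : G, 3 ≤ orderOf g → orderOf g - 2 ∈ ProductOne.deltaStar G) ∧
    (∃ m : ℕ, IsGreatest (ProductOne.deltaStar G) m ∧ m + 2 ≤ ProductOne.davenport G) ∧
    (IsGreatest (ProductOne.deltaStar G) (Nat.card G - 2) ↔
      IsCyclic G ∨ ∃ n : ℕ, 3 ≤ n ∧ Odd n ∧ Nonempty (G ≃* DihedralGroup n)) ∧
    (∀ n : ℕ, 3 ≤ n → Odd n → Nonempty (G ≃* DihedralGroup n) →
      {1, 2, n - 2, 2 * n - 2} ⊆ ProductOne.deltaStar G ∧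
      IsGreatest (ProductOne.deltaStar G \ {2 * n - 2}) (max 2 (n - 2))) ∧
    (IsGreatest (ProductOne.deltaStar G) (ProductOne.davenport G - 2) →
      IsCyclic G ∨ ∃ G₁ : Subgroup G,
        ProductOne.davenport G₁ = ProductOne.davenport G ∧
        Subgroup.closure {g : G | g ∈ G₁ ∧ orderOf g = 2} = G₁) := by
  refine ⟨⟨ProductOne.one_mem_deltaStar hG,
    fun g hg => ProductOne.orderOf_sub_two_mem_deltaStar hg⟩,
    ProductOne.exists_isGreatest_deltaStar hG,
    ProductOne.isGreatest_deltaStar_card_sub_two_iff hG,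
    fun n hn hodd ⟨e⟩ => ?_, ProductOne.isCyclic_or_exists_subgroup⟩
  rw [ProductOne.deltaStar_congr e]
  exact ProductOne.isGreatest_deltaStar_diff hn hodd
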